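/- **Conventions.** Let $P(k,l)$ be the set of set partitions of $\{1,\dots,k\}\sqcup\{1',\dots,l'\}$ ($k$ lower and $l$ upper vertices), and $P_{even}(k,l)\subseteq P(k,l)$ the subset of partitions all of whose blocks have even size. For $p\in P(k,l)$, $q\in P(l,m)$ let $q\star p$ be the partition of the three rows of vertices generated by $p$ and $q$, let $qp\in P(k,m)$ be its restriction to the outer rows, and let $\ell(q,p)$ be the number of blocks of $q\star p$ contained in the middle row ("loops"). A $\mathbb Z_2$-coloured partition of size $(k,l)$ is a pair $(p,z)$, $p\in P(k,l)$, $z$ a labelling of the vertices by $\mathbb Z_2=\{1,-1\}$; $(p,z)$ and $(p,z')$ are identified if $z'=gz$ with $g$ constant on the blocks of $p$. The composition $(q,w)(p,z)$ is defined if there are representatives with $z=w$ on the middle row; it is then the partition $qp$ with the labels of $z$ and $w$ on the outer rows. For $t\in\mathbb C$ let $\underline{\mathrm{Rep}}_0(H_t)$ be the $\mathbb C$-linear category with objects $[k]$, $k\in\mathbb N=\{0,1,2,\dots\}$, $\mathrm{Hom}([k],[l])=\mathbb C P_{even}(k,l)$ and $q\circ p=t^{\ell(q,p)}qp$. Let $\mathrm{Par}(\mathbb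 Z_2,t)$ be the $\mathbb C$-linear category with objects $[\tilde k]$, $k\in\mathbb N$, whose morphism spaces $\mathrm{Hom}([\tilde k],[\tilde l])$ have the $\mathbb Z_2$-coloured partitions of size $(k,l)$ as bases, with $(q,w)\circ(p,z)=t^{\ell(q,p)}(q,w)(p,z)$ if the composition is defined and $0$ otherwise. Tensor products are given by horizontal concatenation. For a $\mathbb C$-linear category $\mathcal C$ let $\mathcal C^{Kar}$ be the idempotent completion of its additive envelope, and let $\underline{\mathrm{Rep}}(H_t)=\underline{\mathrm{Rep}}_0(H_t)^{Kar}$. **The functor $\Omega$.** Let $e'=\tfrac12(\mathrm{id}-s)\in\mathrm{End}([\tilde 1])$, where $s$ is the strand with labels $-1$ (lower vertex) and $1$ (upper vertex). For $f\in P_{even}(k,l)$ with $r$ blocks (viewed as a coloured partition with all labels $1$) put $$\Omega_0(f)=2^{\frac{k+l}{2}-r}\,(e')^{\otimes l}\circ f\circ (e')^{\otimes k},$$ extended linearly. The functor $\Omega:\underline{\mathrm{Rep}}(H_t)\to \mathrm{Par}(\mathbb Z_2,2t)^{Kar}$ sends $(\bigoplus_i[k_i],(f_{ij}))$ to $(\bigoplus_i[\tilde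 k_i],(\Omega_0(f_{ij})))$ and is given by $\Omega_0$ on the entries of matrices of morphisms; in particular $\Omega([k])=([\tilde k],(e')^{\otimes k})$. **The functors $G$ and $H$.** Let $n\in\mathbb N$ and let $H_n=\mathbb Z_2^n\rtimes S_n$ be the hyperoctahedral group, with reflection representation $u=\mathbb C^n$, $(a,\sigma)e_i=a_{\sigma(i)}e_{\sigma(i)}$, and permutation representation $V=\mathbb C^{2n}$ with basis $e^i_b$ ($1\le i\le n$, $b=\pm1$), $(a,\sigma)e^i_b=e^{\sigma(i)}_{a_{\sigma(i)}b}$. Let $\mathrm{Rep}(H_n)$ be the category of its finite-dimensional complex representations. Let $G':\underline{\mathrm{Rep}}_0(H_n)\to\mathrm{Rep}(H_n)$ be the linear functor with $[k]\mapsto u^{\otimes k}$, $p\mapsto T_p$, where the coefficient of $e_{j_1}\otimes\dots\otimes e_{j_l}$ in $T_p(e_{i_1}\otimes\dots\otimes e_{i_k})$ is $1$ if the indices $i_1,\dots,i_k,j_1,\dots,j_l$ are constant on the blocks of $p$, and $0$ otherwise. Let $H':\mathrm{Par}(\mathbb Z_2,2n)\to\mathrm{Rep}(H_n)$ be the linear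 functor with $[\tilde k]\mapsto V^{\otimes k}$, $(p,z)\mapsto T_{(p,z)}$, where the coefficient of $e^{j_1}_{c_1}\otimes\dots\otimes e^{j_l}_{c_l}$ in $T_{(p,z)}(e^{i_1}_{b_1}\otimes\dots\otimes e^{i_k}_{b_k})$ is $1$ if on each block of $p$ the upper indices agree and the products of the lower indices with the labels $z$ agree, and $0$ otherwise. Let $G:\underline{\mathrm{Rep}}(H_n)\to\mathrm{Rep}(H_n)$ and $H:\mathrm{Par}(\mathbb Z_2,2n)^{Kar}\to\mathrm{Rep}(H_n)$ denote $\mathbb C$-linear functors extending $G'$ and $H'$, that is, functors together with natural isomorphisms of their restrictions to $\underline{\mathrm{Rep}}_0(H_n)$ and $\mathrm{Par}(\mathbb Z_2,2n)$ with $G'$ and $H'$ (they are the interpolation, or semisimplification, functors, determined up to isomorphism). **Statement.** For every $n\in\mathbb N$, the functor $\Omega:\underline{\mathrm{Rep}}(H_n)\to\mathrm{Par}(\mathbb Z_2,2n)^{Kar}$ is an equivalence, extensions $G$ and $H$ exist, and the square $H\circ\Omega=G$ commutes: 1. for all choices of the extensions $G$ and $H$ there are a natural isomorphism $\eta:H\circ\Omega\cong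 G$ and a linear map $a:u\to V$ such that, for all $k\in\mathbb N$, the composite $u^{\otimes k}\cong G([k])\cong H(\Omega([k]))\to H([\tilde k])\cong V^{\otimes k}$ is $a^{\otimes k}$, where the second map is $\eta^{-1}$, the third is $H$ of the inclusion $\Omega([k])=([\tilde k],(e')^{\otimes k})\to[\tilde k]$ and the outer isomorphisms belong to the extensions $G$ and $H$; 2. for each choice of $G$ there is a choice of $H$ with $H\circ\Omega=G$ strictly. -/

import Mathlib

open CategoryTheory

namespace Hyperoctahedral

section Partitions

variable {X Y Z W : Type}

/-- The inclusion of the two lower rows into three stacked rows of vertices. -/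
def lowerRows : X ⊕ Y → X ⊕ Y ⊕ Z := Sum.map id Sum.inl

/-- The inclusion of the outer rows into three stacked rows of vertices. -/
def outerRows : X ⊕ Z → X ⊕ Y ⊕ Z := Sum.map id Sum.inr

/-- The stacking of `q` on top of `p`: the smallest equivalence relation on the three rows of
vertices which contains `p` and `q`. -/
def stack (p : Setoid (X ⊕ Y)) (q : Setoid (Y ⊕ Z)) : Setoid (X ⊕ Y ⊕ Z) :=
  sInf {r | (∀ a b, p a b → r (lowerRows a) (lowerRows b)) ∧
    ∀ a b, q a b → r (Sum.inr a) (Sum.inr b)}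

/-- The vertical concatenation `q p` of partitions. -/
def vcomp (p : Setoid (X ⊕ Y)) (q : Setoid (Y ⊕ Z)) : Setoid (X ⊕ Z) :=
  (stack p q).comap outerRows

/-- The number of loops: the connected components of the stacking which lie in the middle row. -/
noncomputable def loops (p : Setoid (X ⊕ Y)) (q : Setoid (Y ⊕ Z)) : ℕ :=
  Nat.card {c : Quotient (stack p q) // ∀ v : X ⊕ Z, Quotient.mk (stack p q) (outerRows v) ≠ c}

/-- The labelling `f` of the vertices is constant on the blocks of `p`. -/
def ConstOn {V S : Type} (p : Setoid V) (f : V → S) : Prop := ∀ a b, p a b → f a = f b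

theorem stack_le {S : Type} (p : Setoid (X ⊕ Y)) (q : Setoid (Y ⊕ Z)) (f : X ⊕ Y ⊕ Z → S) :
    ConstOn (stack p q) f ↔ ConstOn p (f ∘ lowerRows) ∧ ConstOn q (f ∘ Sum.inr) := by
  constructor
  · intro h
    exact ⟨fun a b hab => h _ _ (fun _ hr => hr.1 a b hab),
      fun a b hab => h _ _ (fun _ hr => hr.2 a b hab)⟩
  · rintro ⟨h1, h2⟩ a b hab
    have : stack p q ≤ Setoid.ker f := sInf_le ⟨fun a b h => h1 a b h, fun a b h => h2 a b h⟩
    exact this hab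

/-- Functions on the blocks of the stacking with given values on the outer rows. -/
theorem card_ext {S : Type} [Fintype S] [Finite X] [Finite Y] [Finite Z]
    (p : Setoid (X ⊕ Y)) (q : Setoid (Y ⊕ Z)) (b : X ⊕ Z → S) (hb : ConstOn (vcomp p q) b) :
    Nat.card {g : Quotient (stack p q) → S // ∀ v, g (Quotient.mk _ (outerRows v)) = b v} =
      Fintype.card S ^ loops p q := by
  classical
  have e : {g : Quotient (stack p q) → S // ∀ v, g (Quotient.mk _ (outerRows v)) = b v} ≃
      ({c : Quotient (stack p q) // ∀ v : X ⊕ Z,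
        Quotient.mk (stack p q) (outerRows v) ≠ c} → S) :=
    { toFun := fun g c => g.1 c.1
      invFun := fun h => ⟨fun c => if hc : ∃ v : X ⊕ Z, Quotient.mk (stack p q) (outerRows v) = c
          then b hc.choose else h ⟨c, fun v hv => hc ⟨v, hv⟩⟩, fun v => by
            have hc : ∃ w : X ⊕ Z, Quotient.mk (stack p q) (outerRows w) =
              Quotient.mk (stack p q) (outerRows v) := ⟨v, rfl⟩
            refine (dif_pos hc).trans ?_
            have h3 : stack p q (outerRows hc.choose) (outerRows v) :=
              Quotient.exact hc.choose_spec
            exact hb _ _ h3⟩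
      left_inv := fun g => by
        ext c
        by_cases hc : ∃ v : X ⊕ Z, Quotient.mk (stack p q) (outerRows v) = c
        · simp only [dif_pos hc]
          rw [← g.2, hc.choose_spec]
        · simp only [dif_neg hc]
      right_inv := fun h => by
        ext ⟨c, hc⟩
        have : ¬ ∃ v : X ⊕ Z, Quotient.mk (stack p q) (outerRows v) = c := fun ⟨v, hv⟩ => hc v hv
        simp only [dif_neg this] }
  rw [Nat.card_congr e, Nat.card_fun, Nat.card_eq_fintype_card (α := S)]
  rfl

open scoped Classical in
/-- The matrix of `0`s and `1`s which records the labellings which are constant on blocks;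
columns belong to the lower row and rows to the upper row. -/
noncomputable def kern (S : Type) (R : Type) [Semiring R] (p : Setoid (X ⊕ Y)) :
    Matrix (Y → S) (X → S) R :=
  fun y x => if ConstOn p (Sum.elim x y) then 1 else 0

theorem kern_mul (S R : Type) [Semiring R] [Fintype S] [Finite X] [Fintype Y] [DecidableEq Y]
    [Finite Z]
    (p : Setoid (X ⊕ Y)) (q : Setoid (Y ⊕ Z)) :
    kern S R q * kern S R p = ((Fintype.card S : R) ^ loops p q) • kern S R (vcomp p q) := by
  classical
  ext z x
  rw [Matrix.mul_apply, Matrix.smul_apply, smul_eq_mul]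
  simp only [kern, mul_ite, mul_one, mul_zero, ← ite_and]
  rw [Finset.sum_boole, ← Fintype.card_subtype, ← Nat.card_eq_fintype_card]
  have key : ∀ y : Y → S, (ConstOn p (Sum.elim x y) ∧ ConstOn q (Sum.elim y z)) ↔
      ConstOn (stack p q) (Sum.elim x (Sum.elim y z)) := by
    intro y
    rw [stack_le]
    have h1 : (Sum.elim x (Sum.elim y z)) ∘ lowerRows = Sum.elim x y := by
      ext (a | a) <;> rfl
    have h2 : (Sum.elim x (Sum.elim y z)) ∘ Sum.inr = Sum.elim y z := rfl
    rw [h1, h2]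
  split_ifs with h
  · rw [← Nat.cast_pow, ← card_ext p q _ h]
    congr 1
    refine Nat.card_congr
      { toFun := fun y => ⟨Quotient.lift (Sum.elim x (Sum.elim y.1 z)) ((key y.1).1 y.2), ?_⟩
        invFun := fun g => ⟨fun a => g.1 (Quotient.mk _ (Sum.inr (Sum.inl a))), ?_⟩
        left_inv := fun y => rfl
        right_inv := ?_ }
    · rintro (a | a) <;> rfl
    · rw [key]
      have : Sum.elim x (Sum.elim (fun a => g.1 (Quotient.mk _ (Sum.inr (Sum.inl a)))) z) =
          fun v => g.1 (Quotient.mk _ v) := by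
        ext (a | a | a)
        · exact (g.2 (Sum.inl a)).symm
        · rfl
        · exact (g.2 (Sum.inr a)).symm
      rw [this]
      exact fun a b hab => congrArg g.1 (Quotient.sound hab)
    · rintro ⟨g, hg⟩
      ext c
      induction c using Quotient.ind with | _ v => ?_
      rcases v with a | a | a
      · exact (hg (Sum.inl a)).symm
      · rfl
      · exact (hg (Sum.inr a)).symm
  · convert Nat.cast_zero
    rw [Nat.card_eq_zero]
    left
    refine ⟨fun y => h ?_⟩
    intro a b hab
    have := (key y.1).1 y.2 _ _ hab
    rcases a with a | a <;> rcases b with b | b <;> exact this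


theorem kern_inj {p p' : Setoid (X ⊕ Y)} {a b : ℕ}
    (h : (2 ^ a : ℕ) • kern Bool ℕ p = (2 ^ b : ℕ) • kern Bool ℕ p') : a = b ∧ p = p' := by
  classical
  have h' : ∀ f : X ⊕ Y → Bool, 2 ^ a * (if ConstOn p f then 1 else 0) =
      2 ^ b * (if ConstOn p' f then 1 else 0) := by
    intro f
    have := congrFun (congrFun h (f ∘ Sum.inr)) (f ∘ Sum.inl)
    simpa only [Matrix.smul_apply, kern, Sum.elim_comp_inl_inr, smul_eq_mul] using this
  have hc : ∀ f : X ⊕ Y → Bool, ConstOn p f ↔ ConstOn p' f := by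
    intro f
    have := h' f
    by_cases h1 : ConstOn p f <;> by_cases h2 : ConstOn p' f <;> simp [h1, h2] at this ⊢
    exact pow_ne_zero b (by norm_num) this.symm
  constructor
  · have := h' fun _ => true
    rw [if_pos (show ConstOn p _ from fun _ _ _ => rfl),
      if_pos (show ConstOn p' _ from fun _ _ _ => rfl), mul_one, mul_one] at this
    exact Nat.pow_right_injective le_rfl this
  · have key : ∀ {r r' : Setoid (X ⊕ Y)}, (∀ f : X ⊕ Y → Bool, ConstOn r f → ConstOn r' f) →
        r' ≤ r := by
      intro r r' hrr v w hvw
      have h1 : ConstOn r fun u => decide (r v u) := by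
        intro u u' hu
        exact decide_eq_decide.2 ⟨fun h => r.trans h hu, fun h => r.trans h (r.symm hu)⟩
      have h2 := hrr _ h1 _ _ hvw
      have := decide_eq_decide.1 h2
      exact this.1 (r.refl v)
    exact le_antisymm (key fun f => (hc f).2) (key fun f => (hc f).1)

theorem vcomp_assoc [Finite X] [Finite Y] [Finite Z] [Finite W]
    (p : Setoid (X ⊕ Y)) (q : Setoid (Y ⊕ Z)) (r : Setoid (Z ⊕ W)) :
    loops p q + loops (vcomp p q) r = loops q r + loops p (vcomp q r) ∧
      vcomp (vcomp p q) r = vcomp p (vcomp q r) := by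
  classical
  have := Fintype.ofFinite Y
  have := Fintype.ofFinite Z
  apply kern_inj
  have h := Matrix.mul_assoc (kern Bool ℕ r) (kern Bool ℕ q) (kern Bool ℕ p)
  simp only [kern_mul, Matrix.mul_smul, Matrix.smul_mul, smul_smul, Fintype.card_bool,
    Nat.cast_ofNat, ← pow_add] at h
  exact h.symm

/-- The identity partition, with blocks `{i, i'}`. -/
def idPart (X : Type) : Setoid (X ⊕ X) := Setoid.ker (Sum.elim id id)

theorem kern_id (X S R : Type) [Semiring R] [DecidableEq (X → S)] :
    kern S R (idPart X) = 1 := by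
  classical
  ext y x
  rw [kern, Matrix.one_apply]
  congr 1
  apply propext
  constructor
  · intro h
    ext a
    exact h (Sum.inr a) (Sum.inl a) rfl
  · rintro rfl (a | a) (b | b) (hab : a = b) <;> subst hab <;> rfl

theorem id_vcomp [Finite X] [Finite Y] (p : Setoid (X ⊕ Y)) :
    loops (idPart X) p = 0 ∧ vcomp (idPart X) p = p := by
  classical
  have := Fintype.ofFinite X
  apply kern_inj
  have h := kern_mul Bool ℕ (idPart X) p
  rw [kern_id, Matrix.mul_one] at h
  simpa using h.symm

theorem vcomp_id [Finite X] [Finite Y] (p : Setoid (X ⊕ Y)) :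
    loops p (idPart Y) = 0 ∧ vcomp p (idPart Y) = p := by
  classical
  have := Fintype.ofFinite Y
  apply kern_inj
  have h := kern_mul Bool ℕ p (idPart Y)
  rw [kern_id, Matrix.one_mul] at h
  simpa using h.symm

/-- A partition is even if all its blocks contain an even number of vertices. -/
def IsEven {V : Type} (p : Setoid V) : Prop := ∀ v, Even (Nat.card {w // p v w})

theorem isEven_iff {V : Type} [Fintype V] (p : Setoid V) :
    IsEven p ↔ ∀ f : V → ℤˣ, ConstOn p f → ∏ v, f v = 1 := by
  classical
  constructor
  · intro h f hf
    rw [← Finset.prod_fiberwise (g := fun v => (Quotient.mk p v))]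
    refine Finset.prod_eq_one fun c _ => ?_
    induction c using Quotient.ind with | _ v => ?_
    rw [Finset.prod_congr rfl (g := fun _ => f v), Finset.prod_const]
    · have h2 := h v
      rw [Nat.card_eq_fintype_card, Fintype.card_subtype] at h2
      have h3 : (Finset.univ.filter fun w => Quotient.mk p w = Quotient.mk p v) =
          Finset.univ.filter fun w => p v w := by
        ext w
        simp only [Finset.mem_filter, Finset.mem_univ, true_and]
        exact ⟨fun h => p.symm (Quotient.exact h), fun h => Quotient.sound (p.symm h)⟩
      rw [h3]
      obtain ⟨m, hm⟩ := h2
      rw [hm, ← two_mul, pow_mul, Int.units_sq, one_pow]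
    · intro w hw
      exact hf _ _ (Quotient.exact (Finset.mem_filter.1 hw).2)
  · intro h v
    have h1 : ConstOn p fun w => if p v w then (-1 : ℤˣ) else 1 := by
      intro u u' hu
      have : p v u ↔ p v u' := ⟨fun h => p.trans h hu, fun h => p.trans h (p.symm hu)⟩
      simp only [this]
    have h2 := h _ h1
    rw [Finset.prod_ite, Finset.prod_const_one, mul_one, Finset.prod_const,
      ← Fintype.card_subtype, ← Nat.card_eq_fintype_card] at h2
    by_contra h3
    rw [Nat.not_even_iff_odd] at h3
    rw [h3.neg_one_pow] at h2
    exact absurd h2 (by decide)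

/-- A labelling which is constant on blocks of the vertical concatenation extends to the
stacking. -/
theorem exists_extension {S : Type} [Inhabited S] {p : Setoid (X ⊕ Y)} {q : Setoid (Y ⊕ Z)}
    {f : X ⊕ Z → S} (hf : ConstOn (vcomp p q) f) :
    ∃ F : X ⊕ Y ⊕ Z → S, ConstOn (stack p q) F ∧ F ∘ outerRows = f := by
  classical
  refine ⟨fun v => if h : ∃ w, stack p q (outerRows w) v then f h.choose else default, ?_, ?_⟩
  · intro a b hab
    by_cases h : ∃ w, stack p q (outerRows w) a
    · have h' : ∃ w, stack p q (outerRows w) b := ⟨h.choose, (stack p q).trans h.choose_spec hab⟩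
      simp only [dif_pos h, dif_pos h']
      exact hf _ _ ((stack p q).trans h.choose_spec
        ((stack p q).trans hab ((stack p q).symm h'.choose_spec)))
    · have h' : ¬ ∃ w, stack p q (outerRows w) b := fun ⟨w, hw⟩ =>
        h ⟨w, (stack p q).trans hw ((stack p q).symm hab)⟩
      simp only [dif_neg h, dif_neg h']
  · ext v
    have h : ∃ w, stack p q (outerRows w) (outerRows v) := ⟨v, (stack p q).refl _⟩
    simp only [Function.comp, dif_pos h]
    exact hf _ _ h.choose_spec

theorem IsEven.vcomp [Finite X] [Finite Y] [Finite Z] {p : Setoid (X ⊕ Y)} {q : Setoid (Y ⊕ Z)}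
    (hp : IsEven p) (hq : IsEven q) : IsEven (vcomp p q) := by
  have := Fintype.ofFinite X
  have := Fintype.ofFinite Y
  have := Fintype.ofFinite Z
  rw [isEven_iff] at hp hq ⊢
  intro f hf
  obtain ⟨F, hF, rfl⟩ := exists_extension hf
  rw [stack_le] at hF
  have h1 := hp _ hF.1
  have h2 := hq _ hF.2
  rw [Fintype.prod_sum_type] at h1 h2 ⊢
  have h3 : (∏ a : X, F (Sum.inl a)) * (∏ a : Y, F (Sum.inr (Sum.inl a))) *
    ((∏ a : Y, F (Sum.inr (Sum.inl a))) * (∏ a : Z, F (Sum.inr (Sum.inr a)))) = 1 := by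
    have h4 := congrArg₂ (· * ·) h1 h2
    exact h4.trans (one_mul 1)
  rw [mul_assoc, ← mul_assoc (∏ a : Y, F (Sum.inr (Sum.inl a))), Int.units_mul_self, one_mul] at h3
  exact h3

theorem isEven_idPart (X : Type) [Finite X] : IsEven (idPart X) := by
  have := Fintype.ofFinite X
  rw [isEven_iff]
  intro f hf
  have : ∀ x, f (Sum.inl x) = f (Sum.inr x) := fun x => hf _ _ rfl
  rw [Fintype.prod_sum_type, Finset.prod_congr rfl fun x _ => this x, Int.units_mul_self]

/-- Partitions whose vertices are labelled by `ℤ₂ = {1, -1}`. -/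
abbrev PreCol (X Y : Type) : Type := Setoid (X ⊕ Y) × (X ⊕ Y → ℤˣ)

/-- Two labelled partitions are equivalent if the partitions agree and the labels differ on each
block by a common factor. -/
instance colSetoid (X Y : Type) : Setoid (PreCol X Y) where
  r a b := a.1 = b.1 ∧ ∃ g : X ⊕ Y → ℤˣ, ConstOn a.1 g ∧ ∀ v, b.2 v = g v * a.2 v
  iseqv :=
    { refl := fun a => ⟨rfl, 1, fun _ _ _ => rfl, fun v => (one_mul _).symm⟩
      symm := by
        rintro ⟨p, z⟩ ⟨q, w⟩ ⟨h, g, hg, hz⟩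
        obtain rfl : p = q := h
        refine ⟨rfl, g, hg, fun v => ?_⟩
        simp only at hz
        simp only [hz, ← mul_assoc, Int.units_mul_self, one_mul]
      trans := by
        rintro ⟨p, z⟩ ⟨q, w⟩ ⟨r, u⟩ ⟨h, g, hg, hz⟩ ⟨h', g', hg', hz'⟩
        obtain rfl : p = q := h
        obtain rfl : p = r := h'
        refine ⟨rfl, g' * g, fun a b hab => ?_, fun v => ?_⟩
        · simp only [Pi.mul_apply, hg a b hab, hg' a b hab]
        · simp only at hz hz'
          simp only [hz, hz', Pi.mul_apply, mul_assoc] }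

/-- `ℤ₂`-coloured partitions, equivalent ones being identified. -/
def Col (X Y : Type) : Type := Quotient (colSetoid X Y)

/-- The coloured partition given by a partition and labels. -/
def Col.mk (p : Setoid (X ⊕ Y)) (z : X ⊕ Y → ℤˣ) : Col X Y := Quotient.mk _ (p, z)

/-- The underlying partition. -/
def Col.part (P : Col X Y) : Setoid (X ⊕ Y) :=
  Quotient.lift (s := colSetoid X Y) (fun a => a.1) (fun _ _ h => h.1) P

theorem Col.ind {motive : Col X Y → Prop} (h : ∀ p z, motive (Col.mk p z)) (P : Col X Y) :
    motive P := Quotient.ind (fun a => h a.1 a.2) P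

theorem Col.mk_eq {p : Setoid (X ⊕ Y)} {z w : X ⊕ Y → ℤˣ} :
    Col.mk p z = Col.mk p w ↔ ∃ g : X ⊕ Y → ℤˣ, ConstOn p g ∧ ∀ v, w v = g v * z v :=
  ⟨fun h => (Quotient.exact h).2, fun h => Quotient.sound ⟨rfl, h⟩⟩

theorem Col.mk_eq' {p q : Setoid (X ⊕ Y)} {z w : X ⊕ Y → ℤˣ} (h : Col.mk p z = Col.mk q w) :
    p = q := (Quotient.exact h).1

open scoped Classical in
/-- The vertical concatenation of coloured partitions. It is defined if there are representatives
whose labels agree in the middle row (that is, their products there are `1`, which can be arranged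
by rescaling the blocks of `Q` as soon as these products are constant on the blocks of `Q`). The
outer vertices keep their labels. -/
noncomputable def colMul (P : Col X Y) (Q : Col Y Z) : Option (Col X Z) :=
  if h : ∃ a : PreCol X Y × PreCol Y Z, Col.mk a.1.1 a.1.2 = P ∧ Col.mk a.2.1 a.2.2 = Q ∧
      ∀ y, a.1.2 (Sum.inr y) = a.2.2 (Sum.inl y) then
    some (Col.mk (vcomp h.choose.1.1 h.choose.2.1)
      (Sum.elim (fun x => h.choose.1.2 (Sum.inl x)) (fun z => h.choose.2.2 (Sum.inr z))))
  else none

theorem colMul_mk (p : Setoid (X ⊕ Y)) (q : Setoid (Y ⊕ Z)) (c : X ⊕ Y ⊕ Z → ℤˣ) :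
    colMul (Col.mk p (c ∘ lowerRows)) (Col.mk q (c ∘ Sum.inr)) =
      some (Col.mk (vcomp p q) (c ∘ outerRows)) := by
  have h : ∃ a : PreCol X Y × PreCol Y Z, Col.mk a.1.1 a.1.2 = Col.mk p (c ∘ lowerRows) ∧
      Col.mk a.2.1 a.2.2 = Col.mk q (c ∘ Sum.inr) ∧
      ∀ y, a.1.2 (Sum.inr y) = a.2.2 (Sum.inl y) :=
    ⟨((p, c ∘ lowerRows), (q, c ∘ Sum.inr)), rfl, rfl, fun _ => rfl⟩
  rw [colMul, dif_pos h]
  obtain ⟨h1, h2, h3⟩ := h.choose_spec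
  generalize h.choose = a at h1 h2 h3 ⊢
  obtain ⟨⟨p', z⟩, ⟨q', w⟩⟩ := a
  obtain rfl := Col.mk_eq' h1
  obtain rfl := Col.mk_eq' h2
  obtain ⟨g, hg, hg'⟩ := Col.mk_eq.1 h1
  obtain ⟨k, hk, hk'⟩ := Col.mk_eq.1 h2
  simp only at *
  congr 1
  have hgk : ∀ y, g (Sum.inr y) = k (Sum.inl y) := fun y => by
    have e1 := hg' (Sum.inr y)
    have e2 := hk' (Sum.inl y)
    rw [← h3 y, ← show (c ∘ lowerRows) (Sum.inr y) = (c ∘ Sum.inr) (Sum.inl y) from rfl, e1] at e2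
    exact mul_right_cancel e2
  have hG : ConstOn (stack p' q') (Sum.elim (g ∘ Sum.inl) k) := by
    rw [stack_le]
    have : Sum.elim (g ∘ Sum.inl) k ∘ lowerRows = g := by
      ext (a | a)
      · rfl
      · rw [hgk]; rfl
    rw [this]
    exact ⟨hg, hk⟩
  refine Col.mk_eq.2 ⟨Sum.elim (g ∘ Sum.inl) k ∘ outerRows, fun a b hab => hG _ _ hab, ?_⟩
  rintro (a | a)
  · exact hg' (Sum.inl a)
  · exact hk' (Sum.inr a)

theorem colMul_cases (P : Col X Y) (Q : Col Y Z) :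
    (∃ (p : Setoid (X ⊕ Y)) (q : Setoid (Y ⊕ Z)) (c : X ⊕ Y ⊕ Z → ℤˣ),
      P = Col.mk p (c ∘ lowerRows) ∧ Q = Col.mk q (c ∘ Sum.inr)) ∨
    (colMul P Q = none ∧ ∀ (p : Setoid (X ⊕ Y)) (q : Setoid (Y ⊕ Z)) (c : X ⊕ Y ⊕ Z → ℤˣ),
      ¬ (P = Col.mk p (c ∘ lowerRows) ∧ Q = Col.mk q (c ∘ Sum.inr))) := by
  by_cases h : ∃ a : PreCol X Y × PreCol Y Z, Col.mk a.1.1 a.1.2 = P ∧ Col.mk a.2.1 a.2.2 = Q ∧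
      ∀ y, a.1.2 (Sum.inr y) = a.2.2 (Sum.inl y)
  · left
    obtain ⟨⟨⟨p, z⟩, ⟨q, w⟩⟩, rfl, rfl, h3⟩ := h
    refine ⟨p, q, Sum.elim (z ∘ Sum.inl) w, ?_, rfl⟩
    congr 1
    ext (a | a)
    · rfl
    · exact congrArg Units.val (h3 a)
  · right
    refine ⟨dif_neg h, ?_⟩
    rintro p q c ⟨rfl, rfl⟩
    exact h ⟨((p, c ∘ lowerRows), (q, c ∘ Sum.inr)), rfl, rfl, fun _ => rfl⟩

/-- For a labelling `f` of the vertices by pairs `(i, b)`: on each block the entries `i` agree,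
and so do the products of the entries `b` with the labels of the coloured partition. -/
def ColConst {A : Type} (P : Col X Y) (f : X ⊕ Y → A × ℤˣ) : Prop :=
  Quotient.lift (fun a : PreCol X Y => ConstOn a.1 fun v => ((f v).1, (f v).2 * a.2 v))
    (by
      have key : ∀ (p : Setoid (X ⊕ Y)) (z w g : X ⊕ Y → ℤˣ), ConstOn p g →
          (∀ v, w v = g v * z v) → (ConstOn p fun v => ((f v).1, (f v).2 * z v)) →
          ConstOn p fun v => ((f v).1, (f v).2 * w v) := by
        intro p z w g hg hz h a b hab
        have h1 := h a b hab
        simp only [Prod.mk.injEq] at h1 ⊢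
        refine ⟨h1.1, ?_⟩
        rw [hz, hz, hg a b hab, mul_left_comm, h1.2, mul_left_comm]
      rintro ⟨p, z⟩ ⟨q, w⟩ h
      have h' := (colSetoid X Y).symm h
      obtain ⟨h1, g, hg, hz⟩ := h
      obtain ⟨-, g', hg', hz'⟩ := h'
      obtain rfl : p = q := h1
      exact propext ⟨key p z w g hg hz, key p w z g' hg' hz'⟩) P

theorem colConst_mk {A : Type} (p : Setoid (X ⊕ Y)) (z : X ⊕ Y → ℤˣ) (f : X ⊕ Y → A × ℤˣ) :
    ColConst (Col.mk p z) f ↔ ConstOn p fun v => ((f v).1, (f v).2 * z v) := Iff.rfl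

open scoped Classical in
/-- The matrix of `0`s and `1`s which records the labellings that match a coloured partition. -/
noncomputable def colKern (A : Type) (R : Type) [Semiring R] (P : Col X Y) :
    Matrix (Y → A × ℤˣ) (X → A × ℤˣ) R :=
  fun y x => if ColConst P (Sum.elim x y) then 1 else 0

/-- Multiplication of the signs of a labelling by given signs. -/
def twist {A V : Type} (z : V → ℤˣ) : (V → A × ℤˣ) ≃ (V → A × ℤˣ) where
  toFun f v := ((f v).1, (f v).2 * z v)
  invFun f v := ((f v).1, (f v).2 * z v)
  left_inv f := by ext v <;> simp [mul_assoc, Int.units_mul_self]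
  right_inv f := by ext v <;> simp [mul_assoc, Int.units_mul_self]

theorem colKern_mk (A R : Type) [Semiring R] (p : Setoid (X ⊕ Y)) (z : X ⊕ Y → ℤˣ)
    (y : Y → A × ℤˣ) (x : X → A × ℤˣ) :
    colKern A R (Col.mk p z) y x =
      kern (A × ℤˣ) R p (twist (z ∘ Sum.inr) y) (twist (z ∘ Sum.inl) x) := by
  unfold colKern kern
  congr 1
  rw [colConst_mk]
  congr 1
  ext (a | a) <;> rfl

theorem colKern_mul (A R : Type) [Semiring R] [Fintype A] [Finite X] [Fintype Y] [DecidableEq Y]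
    [Finite Z] (P : Col X Y) (Q : Col Y Z) :
    colKern A R Q * colKern A R P = (colMul P Q).elim 0 fun U =>
      ((Fintype.card (A × ℤˣ) : R) ^ loops P.part Q.part) • colKern A R U := by
  classical
  rcases colMul_cases P Q with ⟨p, q, c, rfl, rfl⟩ | ⟨h, h'⟩
  · rw [colMul_mk]
    ext z x
    have h := congrFun (congrFun (kern_mul (A × ℤˣ) R p q)
      (twist (fun a => c (Sum.inr (Sum.inr a))) z)) (twist (fun a => c (Sum.inl a)) x)
    rw [Matrix.mul_apply] at h
    simp only [Option.elim, Matrix.mul_apply, Matrix.smul_apply, colKern_mk] at h ⊢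
    rw [← (twist fun a => c (Sum.inr (Sum.inl a))).sum_comp] at h
    exact h
  · rw [h]
    ext z x
    simp only [Option.elim, Matrix.mul_apply, Matrix.zero_apply]
    refine Finset.sum_eq_zero fun y _ => ?_
    unfold colKern
    by_contra hne
    have h1 : ColConst Q (Sum.elim y z) ∧ ColConst P (Sum.elim x y) := by
      by_cases h1 : ColConst Q (Sum.elim y z) <;> by_cases h2 : ColConst P (Sum.elim x y) <;>
        simp [h1, h2] at hne ⊢
    obtain ⟨h1, h2⟩ := h1
    induction P using Col.ind with | _ p u => ?_
    induction Q using Col.ind with | _ q w => ?_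
    rw [colConst_mk] at h1 h2
    refine h' p q (fun v => (Sum.elim x (Sum.elim y z) v).2) ⟨Col.mk_eq.2
      ⟨fun v => (Sum.elim x y v).2 * u v, fun a b hab => (Prod.ext_iff.1 (h2 a b hab)).2, ?_⟩,
      Col.mk_eq.2 ⟨fun v => (Sum.elim y z v).2 * w v, fun a b hab =>
        (Prod.ext_iff.1 (h1 a b hab)).2, ?_⟩⟩
    · rintro (a | a) <;> simp [mul_assoc, Int.units_mul_self, lowerRows]
    · rintro (a | a) <;> simp [mul_assoc, Int.units_mul_self]

theorem colConst_inj {P Q : Col X Y}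
    (h : ∀ f : X ⊕ Y → Bool × ℤˣ, ColConst P f ↔ ColConst Q f) : P = Q := by
  classical
  have key : ∀ {P Q : Col X Y}, (∀ f : X ⊕ Y → Bool × ℤˣ, ColConst P f ↔ ColConst Q f) →
      Q.part ≤ P.part := by
    intro P Q h
    induction P using Col.ind with | _ p z => ?_
    induction Q using Col.ind with | _ q w => ?_
    intro v v' hv
    have h1 : ColConst (Col.mk p z) fun u => (decide (p v u), z u) := by
      intro u u' hu
      simp only [Int.units_mul_self, Prod.mk.injEq, and_true]
      exact decide_eq_decide.2 ⟨fun h => p.trans h hu, fun h => p.trans h (p.symm hu)⟩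
    rw [h] at h1
    have h2 := (Prod.ext_iff.1 (h1 v v' hv)).1
    exact (decide_eq_decide.1 h2).1 (p.refl v)
  have h1 := le_antisymm (key fun f => (h f).symm) (key h)
  induction P using Col.ind with | _ p z => ?_
  induction Q using Col.ind with | _ q w => ?_
  obtain rfl : p = q := h1
  have h2 : ColConst (Col.mk p z) fun u => (true, z u) := by
    intro u u' hu
    simp only [Int.units_mul_self]
  rw [h] at h2
  refine Col.mk_eq.2 ⟨fun v => z v * w v, fun a b hab => (Prod.ext_iff.1 (h2 a b hab)).2, ?_⟩
  intro v
  rw [mul_comm, ← mul_assoc, Int.units_mul_self, one_mul]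

/-- The matrix of a coloured partition with a number of loops, or of nothing. -/
noncomputable def wt (o : Option (ℕ × Col X Y)) : Matrix (Y → Bool × ℤˣ) (X → Bool × ℤˣ) ℕ :=
  o.elim 0 fun a => 4 ^ a.1 • colKern Bool ℕ a.2

theorem wt_injective : Function.Injective (wt (X := X) (Y := Y)) := by
  classical
  have hpos : ∀ P : Col X Y, ∃ f : X ⊕ Y → Bool × ℤˣ, ColConst P f := by
    intro P
    induction P using Col.ind with | _ p z => ?_
    exact ⟨fun v => (true, z v), fun u u' _ => by simp only [Int.units_mul_self]⟩
  have hw : ∀ (o : Option (ℕ × Col X Y)) (f : X ⊕ Y → Bool × ℤˣ),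
      wt o (f ∘ Sum.inr) (f ∘ Sum.inl) = o.elim 0 fun a => 4 ^ a.1 *
        if ColConst a.2 f then 1 else 0 := by
    intro o f
    rcases o with _ | ⟨a, P⟩
    · rfl
    · simp [wt, colKern]
  rintro (_ | ⟨a, P⟩) (_ | ⟨b, Q⟩) h
  · rfl
  · obtain ⟨f, hf⟩ := hpos Q
    have := hw none f
    rw [h, hw] at this
    simp [hf] at this
  · obtain ⟨f, hf⟩ := hpos P
    have := hw none f
    rw [← h, hw] at this
    simp [hf] at this
  · have h1 : ∀ f : X ⊕ Y → Bool × ℤˣ, 4 ^ a * (if ColConst P f then 1 else 0) =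
        4 ^ b * if ColConst Q f then 1 else 0 := fun f =>
      (hw (some (a, P)) f).symm.trans ((congrFun (congrFun h _) _).trans (hw (some (b, Q)) f))
    have h2 : P = Q := by
      refine colConst_inj fun f => ?_
      have := h1 f
      by_cases h3 : ColConst P f <;> by_cases h4 : ColConst Q f <;> simp [h3, h4] at this ⊢
      exact pow_ne_zero b (by norm_num) this.symm
    subst h2
    obtain ⟨f, hf⟩ := hpos P
    have := h1 f
    rw [if_pos hf, mul_one, mul_one] at this
    rw [Nat.pow_right_injective (by norm_num) this]

theorem colMul_assoc [Finite X] [Finite Y] [Finite Z] [Finite W]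
    (P : Col X Y) (Q : Col Y Z) (R : Col Z W) :
    ((colMul P Q).bind fun U => (colMul U R).map fun V =>
      (loops P.part Q.part + loops U.part R.part, V)) =
    (colMul Q R).bind fun U => (colMul P U).map fun V =>
      (loops Q.part R.part + loops P.part U.part, V) := by
  classical
  have := Fintype.ofFinite Y
  have := Fintype.ofFinite Z
  apply wt_injective
  have h := Matrix.mul_assoc (colKern Bool ℕ R) (colKern Bool ℕ Q) (colKern Bool ℕ P)
  have hc : (Fintype.card (Bool × ℤˣ) : ℕ) = 4 := rfl
  rw [colKern_mul, colKern_mul, hc] at h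
  have h1 : wt ((colMul P Q).bind fun U => (colMul U R).map fun V =>
      (loops P.part Q.part + loops U.part R.part, V)) = colKern Bool ℕ R *
      ((colMul P Q).elim 0 fun U => 4 ^ loops P.part Q.part • colKern Bool ℕ U) := by
    rcases colMul P Q with _ | U
    · simp [wt]
    · simp only [Option.bind_some, Option.elim, Matrix.mul_smul, colKern_mul, hc]
      rcases colMul U R with _ | V
      · simp [wt]
      · simp [wt, smul_smul, pow_add]
  have h2 : wt ((colMul Q R).bind fun U => (colMul P U).map fun V =>
      (loops Q.part R.part + loops P.part U.part, V)) =
      ((colMul Q R).elim 0 fun U => 4 ^ loops Q.part R.part • colKern Bool ℕ U) *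
        colKern Bool ℕ P := by
    rcases colMul Q R with _ | U
    · simp [wt]
    · simp only [Option.bind_some, Option.elim, Matrix.smul_mul, colKern_mul, hc]
      rcases colMul P U with _ | V
      · simp [wt]
      · simp [wt, smul_smul, pow_add]
  rw [h1, h2]
  exact h.symm

/-- The coloured identity partition with labels `z` on the lower row. -/
def strand (z : X → ℤˣ) : Col X X := Col.mk (idPart X) (Sum.elim z 1)

theorem strand_colMul [Finite X] [Finite Y] (z : X → ℤˣ) (p : Setoid (X ⊕ Y)) (w : X ⊕ Y → ℤˣ) :
    colMul (strand z) (Col.mk p w) =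
      some (Col.mk p (Sum.elim (z * (w ∘ Sum.inl)) (w ∘ Sum.inr))) := by
  have h := colMul_mk (idPart X) p (Sum.elim (z * (w ∘ Sum.inl)) w)
  rw [(id_vcomp p).2] at h
  have h1 : strand z = Col.mk (idPart X) (Sum.elim (z * (w ∘ Sum.inl)) w ∘ lowerRows) := by
    refine Col.mk_eq.2 ⟨Sum.elim (w ∘ Sum.inl) (w ∘ Sum.inl), ?_, ?_⟩
    · rintro (a | a) (b | b) (hab : a = b) <;> subst hab <;> rfl
    · rintro (a | a)
      · exact mul_comm _ _
      · exact (mul_one _).symm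
  have h2 : (Sum.elim (z * (w ∘ Sum.inl)) w ∘ outerRows) =
      (Sum.elim (z * (w ∘ Sum.inl)) (w ∘ Sum.inr)) := by
    ext (a | a) <;> rfl
  rw [h1, ← h2, ← h]
  rfl

theorem colMul_strand [Finite X] [Finite Y] (z : Y → ℤˣ) (p : Setoid (X ⊕ Y)) (w : X ⊕ Y → ℤˣ) :
    colMul (Col.mk p w) (strand z) =
      some (Col.mk p (Sum.elim (w ∘ Sum.inl) (z * (w ∘ Sum.inr)))) := by
  have h := colMul_mk p (idPart Y) (Sum.elim (w ∘ Sum.inl)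
    (Sum.elim (w ∘ Sum.inr) (z * (w ∘ Sum.inr))))
  rw [(vcomp_id p).2] at h
  have h1 : strand z = Col.mk (idPart Y) (Sum.elim (w ∘ Sum.inl)
    (Sum.elim (w ∘ Sum.inr) (z * (w ∘ Sum.inr))) ∘ Sum.inr) := by
    refine Col.mk_eq.2 ⟨Sum.elim (z * (w ∘ Sum.inr)) (z * (w ∘ Sum.inr)), ?_, ?_⟩
    · rintro (a | a) (b | b) (hab : a = b) <;> subst hab <;> rfl
    · rintro (a | a)
      · simp [mul_assoc, mul_comm (z a), Int.units_mul_self]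
      · exact (mul_one _).symm
  have h2 : (Sum.elim (w ∘ Sum.inl) (Sum.elim (w ∘ Sum.inr) (z * (w ∘ Sum.inr))) ∘ outerRows) =
      (Sum.elim (w ∘ Sum.inl) (z * (w ∘ Sum.inr))) := by
    ext (a | a) <;> rfl
  have h3 : (Sum.elim (w ∘ Sum.inl) (Sum.elim (w ∘ Sum.inr) (z * (w ∘ Sum.inr))) ∘ lowerRows) =
      w := by
    ext (a | a) <;> rfl
  rw [h3] at h
  rw [h1, h, ← h2]

theorem id_colMul [Finite X] [Finite Y] (P : Col X Y) :
    colMul (strand 1) P = some P ∧ colMul P (strand 1) = some P := by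
  induction P using Col.ind with | _ p w => ?_
  constructor
  · rw [strand_colMul]
    congr 2
    ext (a | a) <;> simp
  · rw [colMul_strand]
    congr 2
    ext (a | a) <;> simp

/-- The blocks of the stacking are those which meet the outer rows and the loops. -/
theorem card_stack [Finite X] [Finite Y] [Finite Z] (p : Setoid (X ⊕ Y)) (q : Setoid (Y ⊕ Z)) :
    Nat.card (Quotient (stack p q)) = Nat.card (Quotient (vcomp p q)) + loops p q := by
  classical
  have e : Quotient (vcomp p q) ≃ {c : Quotient (stack p q) //
      ¬ ∀ v : X ⊕ Z, Quotient.mk (stack p q) (outerRows v) ≠ c} :=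
    Equiv.ofBijective (fun c => ⟨Quotient.map' (s₁ := vcomp p q) (s₂ := stack p q)
        outerRows (fun _ _ h => h) c, by
          induction c using Quotient.ind with | _ v => ?_
          exact fun h => h v rfl⟩) (by
      constructor
      · intro c d hcd
        induction c using Quotient.ind with | _ v => ?_
        induction d using Quotient.ind with | _ w => ?_
        have h1 : Quotient.mk (stack p q) (outerRows v) = Quotient.mk (stack p q) (outerRows w) :=
          congrArg Subtype.val hcd
        have h2 : stack p q (outerRows v) (outerRows w) := Quotient.exact h1
        exact Quotient.sound h2
      · rintro ⟨c, hc⟩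
        push Not at hc
        obtain ⟨v, rfl⟩ := hc
        exact ⟨Quotient.mk _ v, rfl⟩)
  rw [Nat.card_congr e, loops, add_comm,
    ← Nat.card_congr (Equiv.sumCompl fun c : Quotient (stack p q) =>
      ∀ v : X ⊕ Z, Quotient.mk (stack p q) (outerRows v) ≠ c), Nat.card_sum]

/-- The labels of the middle row which come from block-constant labels of `p` and of `q`. -/
def midHom (p : Setoid (X ⊕ Y)) (q : Setoid (Y ⊕ Z)) :
    (Quotient p → ℤˣ) × (Quotient q → ℤˣ) →* (Y → ℤˣ) where
  toFun a y := a.1 (Quotient.mk _ (Sum.inr y)) * a.2 (Quotient.mk _ (Sum.inl y))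
  map_one' := by ext; simp
  map_mul' a b := by ext; simp [mul_mul_mul_comm]

theorem card_range_midHom [Finite X] [Finite Y] [Finite Z] (p : Setoid (X ⊕ Y))
    (q : Setoid (Y ⊕ Z)) :
    Nat.card (midHom p q).range * 2 ^ Nat.card (Quotient (stack p q)) =
      2 ^ (Nat.card (Quotient p) + Nat.card (Quotient q)) := by
  classical
  have hpq : ∀ f : Quotient (stack p q) → ℤˣ,
      ConstOn p ((fun v => f (Quotient.mk _ v)) ∘ lowerRows) ∧
        ConstOn q ((fun v => f (Quotient.mk _ v)) ∘ Sum.inr) := fun f =>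
    (stack_le p q _).1 fun a b hab => congrArg f (Quotient.sound hab)
  have e : (midHom p q).ker ≃ (Quotient (stack p q) → ℤˣ) :=
    { toFun := fun a => Quotient.lift (Sum.elim (fun x => a.1.1 (Quotient.mk _ (Sum.inl x)))
          (fun v => a.1.2 (Quotient.mk _ v))) (by
            have h := a.2
            rw [MonoidHom.mem_ker] at h
            refine (stack_le p q _).2 ⟨?_, fun v w hvw => congrArg a.1.2 (Quotient.sound hvw)⟩
            have h1 : (Sum.elim (fun x => a.1.1 (Quotient.mk _ (Sum.inl x)))
                (fun v => a.1.2 (Quotient.mk _ v))) ∘ lowerRows =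
                fun v => a.1.1 (Quotient.mk _ v) := by
              ext (x | y)
              · rfl
              · have h2 : a.1.1 (Quotient.mk _ (Sum.inr y)) * a.1.2 (Quotient.mk _ (Sum.inl y)) = 1 :=
                  congrFun h y
                rw [mul_eq_one_iff_eq_inv, Int.units_inv_eq_self] at h2
                exact congrArg Units.val h2.symm
            rw [h1]
            exact fun v w hvw => congrArg a.1.1 (Quotient.sound hvw))
      invFun := fun f => ⟨(Quotient.lift _ (hpq f).1, Quotient.lift _ (hpq f).2), by
        rw [MonoidHom.mem_ker]
        ext y
        exact congrArg Units.val (Int.units_mul_self (f (Quotient.mk _ (Sum.inr (Sum.inl y)))))⟩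
      left_inv := by
        rintro ⟨⟨a, b⟩, h⟩
        rw [MonoidHom.mem_ker] at h
        apply Subtype.ext
        apply Prod.ext
        · funext c
          induction c using Quotient.ind with | _ v => ?_
          rcases v with x | y
          · rfl
          · have h2 : a (Quotient.mk _ (Sum.inr y)) * b (Quotient.mk _ (Sum.inl y)) = 1 :=
              congrFun h y
            rw [mul_eq_one_iff_eq_inv, Int.units_inv_eq_self] at h2
            exact h2.symm
        · funext c
          induction c using Quotient.ind with | _ v => ?_
          rfl
      right_inv := by
        intro f
        funext c
        induction c using Quotient.ind with | _ v => ?_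
        rcases v with x | v <;> rfl }
  have h1 := (midHom p q).ker.card_mul_index
  have h2 : Nat.card ℤˣ = 2 := by rw [Nat.card_eq_fintype_card]; rfl
  rw [Subgroup.index_ker, Nat.card_congr e, Nat.card_fun, Nat.card_prod, Nat.card_fun,
    Nat.card_fun, h2, ← pow_add] at h1
  rw [mul_comm]
  exact h1

/-- The horizontal concatenation of partitions on disjoint sets of vertices. -/
def sumSetoid {V V' : Type} (p : Setoid V) (q : Setoid V') : Setoid (V ⊕ V') where
  r := Sum.LiftRel p q
  iseqv :=
    { refl := by
        rintro (a | a)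
        · exact Sum.LiftRel.inl (p.refl a)
        · exact Sum.LiftRel.inr (q.refl a)
      symm := by
        rintro _ _ (⟨h⟩ | ⟨h⟩)
        · exact Sum.LiftRel.inl (p.symm h)
        · exact Sum.LiftRel.inr (q.symm h)
      trans := by
        rintro _ _ _ (⟨h⟩ | ⟨h⟩) (⟨h'⟩ | ⟨h'⟩)
        · exact Sum.LiftRel.inl (p.trans h h')
        · exact Sum.LiftRel.inr (q.trans h h') }

/-- The vertices of a horizontal concatenation are those of the left and of the right partition. -/
def splitRows (k k' l l' : ℕ) :
    Fin (k + k') ⊕ Fin (l + l') ≃ (Fin k ⊕ Fin l) ⊕ (Fin k' ⊕ Fin l') :=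
  (Equiv.sumCongr finSumFinEquiv.symm finSumFinEquiv.symm).trans (Equiv.sumSumSumComm _ _ _ _)

/-- The horizontal concatenation of coloured partitions. -/
def hconcat {k k' l l' : ℕ} (P : Col (Fin k) (Fin l)) (Q : Col (Fin k') (Fin l')) :
    Col (Fin (k + k')) (Fin (l + l')) :=
  Quotient.map₂ (sa := colSetoid _ _) (sb := colSetoid _ _) (sc := colSetoid _ _)
    (fun a b => ((sumSetoid a.1 b.1).comap (splitRows k k' l l'),
      Sum.elim a.2 b.2 ∘ splitRows k k' l l'))
    (by
      rintro ⟨p, z⟩ ⟨p', z'⟩ ⟨h, g, hg, hz⟩ ⟨q, w⟩ ⟨q', w'⟩ ⟨h', g', hg', hw⟩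
      obtain rfl : p = p' := h
      obtain rfl : q = q' := h'
      refine ⟨rfl, Sum.elim g g' ∘ splitRows k k' l l', ?_, ?_⟩
      · intro a b hab
        have hab' : Sum.LiftRel p q (splitRows k k' l l' a) (splitRows k k' l l' b) := hab
        simp only [Function.comp]
        generalize splitRows k k' l l' a = a' at hab'
        generalize splitRows k k' l l' b = b' at hab'
        obtain ⟨h⟩ | ⟨h⟩ := hab'
        · exact hg _ _ h
        · exact hg' _ _ h
      · intro v
        simp only [Function.comp]
        rcases splitRows k k' l l' v with a | a
        · exact hz a
        · exact hw a) P Q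

theorem hconcat_strand {k l : ℕ} (z : Fin k → ℤˣ) (w : Fin l → ℤˣ) :
    hconcat (strand z) (strand w) = strand (Sum.elim z w ∘ finSumFinEquiv.symm) := by
  change Col.mk _ _ = Col.mk _ _
  have h1 : (sumSetoid (idPart (Fin k)) (idPart (Fin l))).comap (splitRows k l k l) =
      idPart (Fin (k + l)) := by
    have h2 : ∀ a b : (Fin k ⊕ Fin l) ⊕ (Fin k ⊕ Fin l),
        Sum.LiftRel (idPart (Fin k)) (idPart (Fin l)) (Equiv.sumSumSumComm _ _ _ _ a)
          (Equiv.sumSumSumComm _ _ _ _ b) ↔ Sum.elim id id a = Sum.elim id id b := by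
      rintro ((a | a) | (a | a)) ((b | b) | (b | b)) <;>
        simp [Equiv.sumSumSumComm] <;> exact Iff.rfl
    ext a b
    have h3 := h2 (Equiv.sumCongr finSumFinEquiv.symm finSumFinEquiv.symm a)
      (Equiv.sumCongr finSumFinEquiv.symm finSumFinEquiv.symm b)
    refine h3.trans ?_
    have h4 : ∀ a : Fin (k + l) ⊕ Fin (k + l), Sum.elim id id
      (Equiv.sumCongr finSumFinEquiv.symm finSumFinEquiv.symm a) =
      finSumFinEquiv.symm (Sum.elim id id a) := by rintro (a | a) <;> rfl
    rw [h4, h4, EmbeddingLike.apply_eq_iff_eq]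
    rfl
  rw [h1]
  congr 1
  ext (a | a)
  · simp only [splitRows, Function.comp, Equiv.trans_apply, Equiv.sumCongr_apply, Sum.map_inl,
      Sum.elim_inl]
    rcases finSumFinEquiv.symm a with b | b <;> rfl
  · simp only [splitRows, Function.comp, Equiv.trans_apply, Equiv.sumCongr_apply, Sum.map_inr,
      Sum.elim_inr]
    rcases finSumFinEquiv.symm a with b | b <;> rfl

end Partitions

section Categories

/-- The bilinear extension of a map on basis elements. -/
noncomputable def bilin {A B C : Type} (m : A → B → (C →₀ ℂ)) :
    (A →₀ ℂ) →ₗ[ℂ] (B →₀ ℂ) →ₗ[ℂ] (C →₀ ℂ) :=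
  Finsupp.linearCombination ℂ fun a => Finsupp.linearCombination ℂ (m a)

theorem bilin_single {A B C : Type} (m : A → B → (C →₀ ℂ)) (a : A) (b : B) (r s : ℂ) :
    bilin m (Finsupp.single a r) (Finsupp.single b s) = (r * s) • m a b := by
  simp [bilin, smul_smul]

theorem bilin_add_left {A B C : Type} (m : A → B → (C →₀ ℂ)) (f f' : A →₀ ℂ) (g : B →₀ ℂ) :
    bilin m (f + f') g = bilin m f g + bilin m f' g := by
  rw [map_add, LinearMap.add_apply]

theorem bilin_add_right {A B C : Type} (m : A → B → (C →₀ ℂ)) (f : A →₀ ℂ) (g g' : B →₀ ℂ) :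
    bilin m f (g + g') = bilin m f g + bilin m f g' := map_add _ _ _

theorem bilin_smul_left {A B C : Type} (m : A → B → (C →₀ ℂ)) (r : ℂ) (f : A →₀ ℂ)
    (g : B →₀ ℂ) : bilin m (r • f) g = r • bilin m f g := by
  rw [map_smul, LinearMap.smul_apply]

theorem bilin_smul_right {A B C : Type} (m : A → B → (C →₀ ℂ)) (f : A →₀ ℂ) (r : ℂ)
    (g : B →₀ ℂ) : bilin m f (r • g) = r • bilin m f g := map_smul _ _ _

theorem bilin_assoc {A B C D E F : Type} {m₁ : A → B → (D →₀ ℂ)} {m₂ : D → C → (E →₀ ℂ)}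
    {m₃ : B → C → (F →₀ ℂ)} {m₄ : A → F → (E →₀ ℂ)}
    (h : ∀ a b c, bilin m₂ (m₁ a b) (Finsupp.single c 1) =
      bilin m₄ (Finsupp.single a 1) (m₃ b c))
    (f : A →₀ ℂ) (g : B →₀ ℂ) (k : C →₀ ℂ) :
    bilin m₂ (bilin m₁ f g) k = bilin m₄ f (bilin m₃ g k) := by
  induction f using Finsupp.induction_linear with
  | zero => simp
  | add f f' hf hf' => simp [hf, hf']
  | single a r =>
    induction g using Finsupp.induction_linear with
    | zero => simp
    | add g g' hg hg' => simp [hg, hg']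
    | single b s =>
      induction k using Finsupp.induction_linear with
      | zero => simp
      | add k k' hk hk' => simp [hk, hk']
      | single c t =>
        have h1 : Finsupp.single c t = t • Finsupp.single c (1 : ℂ) := by simp
        have h2 : Finsupp.single a r = r • Finsupp.single a (1 : ℂ) := by simp
        rw [bilin_single, bilin_single, h1, h2]
        simp only [map_smul, LinearMap.smul_apply, h, smul_smul]
        congr 1
        ring

/-- Even partitions of `k` lower and `l` upper vertices. -/
abbrev EvenPart (k l : ℕ) : Type := {p : Setoid (Fin k ⊕ Fin l) // IsEven p}

/-- The composition of even partitions, with a factor `t` for every loop. -/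
noncomputable def evenComp (t : ℂ) {k l m : ℕ} (p : EvenPart k l) (q : EvenPart l m) :
    EvenPart k m →₀ ℂ :=
  Finsupp.single ⟨vcomp p.1 q.1, p.2.vcomp q.2⟩ (t ^ loops p.1 q.1)

/-- The category of even partitions with parameter `t`; its objects are `[n]` for `n : ℕ`. -/
structure RepZero (t : ℂ) : Type where
  n : ℕ

noncomputable instance (t : ℂ) : Category (RepZero t) where
  Hom k l := EvenPart k.n l.n →₀ ℂ
  id k := Finsupp.single ⟨idPart (Fin k.n), isEven_idPart _⟩ 1
  comp f g := bilin (evenComp t) f g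
  id_comp f := by
    induction f using Finsupp.induction_linear with
    | zero => simp
    | add f g hf hg => rw [map_add, hf, hg]
    | single p r =>
      rw [bilin_single, evenComp]
      simp only [id_vcomp]
      simp
  comp_id f := by
    induction f using Finsupp.induction_linear with
    | zero => simp
    | add f g hf hg => rw [map_add, LinearMap.add_apply, hf, hg]
    | single p r =>
      rw [bilin_single, evenComp]
      simp only [vcomp_id]
      simp
  assoc f g h := by
    refine bilin_assoc (fun p q r => ?_) f g h
    rw [evenComp, evenComp, bilin_single, bilin_single, evenComp, evenComp]
    have := vcomp_assoc p.1 q.1 r.1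
    simp only [this.2, mul_one, one_mul, Finsupp.smul_single, smul_eq_mul, ← pow_add, this.1]

noncomputable instance (t : ℂ) : Preadditive (RepZero t) where
  homGroup k l := inferInstanceAs (AddCommGroup (EvenPart k.n l.n →₀ ℂ))
  add_comp k l m f f' g := bilin_add_left (A := EvenPart k.n l.n) (B := EvenPart l.n m.n)
    (C := EvenPart k.n m.n) (evenComp t) f f' g
  comp_add k l m f g g' := bilin_add_right (A := EvenPart k.n l.n) (B := EvenPart l.n m.n)
    (C := EvenPart k.n m.n) (evenComp t) f g g'

noncomputable instance (t : ℂ) : Linear ℂ (RepZero t) where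
  homModule k l := inferInstanceAs (Module ℂ (EvenPart k.n l.n →₀ ℂ))
  smul_comp k l m r f g := bilin_smul_left (A := EvenPart k.n l.n) (B := EvenPart l.n m.n)
    (C := EvenPart k.n m.n) (evenComp t) r f g
  comp_smul k l m f r g := bilin_smul_right (A := EvenPart k.n l.n) (B := EvenPart l.n m.n)
    (C := EvenPart k.n m.n) (evenComp t) f r g

/-- The morphism given by an even partition. -/
noncomputable def RepZero.ofPart (t : ℂ) {k l : ℕ} (p : EvenPart k l) :
    (⟨k⟩ : RepZero t) ⟶ ⟨l⟩ := Finsupp.single p (1 : ℂ)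

theorem RepZero.hom_induction {t : ℂ} {k l : ℕ} {motive : ((⟨k⟩ : RepZero t) ⟶ ⟨l⟩) → Prop}
    (zero : motive 0) (plus : ∀ f g, motive f → motive g → motive (f + g))
    (smul : ∀ (r : ℂ) (p : EvenPart k l), motive (r • RepZero.ofPart t p))
    (f : (⟨k⟩ : RepZero t) ⟶ ⟨l⟩) : motive f := by
  refine Finsupp.induction_linear (motive := motive) f zero plus fun p r => ?_
  have h := smul r p
  have h2 : r • RepZero.ofPart t p = Finsupp.single p r :=
    (Finsupp.smul_single _ _ _).trans (by rw [smul_eq_mul, mul_one])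
  rwa [h2] at h

/-- The composition of coloured partitions, with a factor `t` for every loop. It is zero if the
vertical concatenation is not defined. -/
noncomputable def colComp (t : ℂ) {k l m : ℕ} (P : Col (Fin k) (Fin l)) (Q : Col (Fin l) (Fin m)) :
    Col (Fin k) (Fin m) →₀ ℂ :=
  (colMul P Q).elim 0 fun U => Finsupp.single U (t ^ loops P.part Q.part)

/-- The category of `ℤ₂`-coloured partitions with parameter `t`; its objects are `[n]` for
`n : ℕ`. -/
structure Par (t : ℂ) : Type where
  n : ℕ

noncomputable instance (t : ℂ) : Category (Par t) where
  Hom k l := Col (Fin k.n) (Fin l.n) →₀ ℂ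
  id k := Finsupp.single (Col.mk (idPart (Fin k.n)) 1) 1
  comp f g := bilin (colComp t) f g
  id_comp {k l} f := by
    have h : Col.mk (idPart (Fin k.n)) 1 = strand 1 := congrArg _ (by ext (a | a) <;> rfl)
    induction f using Finsupp.induction_linear with
    | zero => simp
    | add f g hf hg => rw [map_add, hf, hg]
    | single p r =>
      rw [bilin_single, colComp, h, (id_colMul p).1, Option.elim,
        show loops (strand 1).part p.part = 0 from (id_vcomp p.part).1]
      simp
  comp_id {k l} f := by
    have h : Col.mk (idPart (Fin l.n)) 1 = strand 1 := congrArg _ (by ext (a | a) <;> rfl)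
    induction f using Finsupp.induction_linear with
    | zero => simp
    | add f g hf hg => rw [map_add, LinearMap.add_apply, hf, hg]
    | single p r =>
      rw [bilin_single, colComp, h, (id_colMul p).2, Option.elim,
        show loops p.part (strand 1).part = 0 from (vcomp_id p.part).1]
      simp
  assoc f g h := by
    refine bilin_assoc (fun P Q R => ?_) f g h
    have h1 := colMul_assoc P Q R
    have h2 := congrArg (fun o => o.elim (0 : _ →₀ ℂ) fun a => Finsupp.single a.2 (t ^ a.1)) h1
    refine Eq.trans ?_ (h2.trans ?_)
    · rw [colComp]
      rcases colMul P Q with _ | U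
      · simp
      · simp only [Option.elim, Option.bind_some, bilin_single, colComp]
        rcases colMul U R with _ | V
        · simp
        · simp [pow_add]
    · rw [colComp]
      rcases colMul Q R with _ | U
      · simp
      · simp only [Option.elim, Option.bind_some, bilin_single, colComp]
        rcases colMul P U with _ | V
        · simp
        · simp [pow_add]

noncomputable instance (t : ℂ) : Preadditive (Par t) where
  homGroup k l := inferInstanceAs (AddCommGroup (Col (Fin k.n) (Fin l.n) →₀ ℂ))
  add_comp k l m f f' g := bilin_add_left (A := Col (Fin k.n) (Fin l.n)) (B := Col (Fin l.n) (Fin m.n))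
    (C := Col (Fin k.n) (Fin m.n)) (colComp t) f f' g
  comp_add k l m f g g' := bilin_add_right (A := Col (Fin k.n) (Fin l.n)) (B := Col (Fin l.n) (Fin m.n))
    (C := Col (Fin k.n) (Fin m.n)) (colComp t) f g g'

noncomputable instance (t : ℂ) : Linear ℂ (Par t) where
  homModule k l := inferInstanceAs (Module ℂ (Col (Fin k.n) (Fin l.n) →₀ ℂ))
  smul_comp k l m r f g := bilin_smul_left (A := Col (Fin k.n) (Fin l.n)) (B := Col (Fin l.n) (Fin m.n))
    (C := Col (Fin k.n) (Fin m.n)) (colComp t) r f g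
  comp_smul k l m f r g := bilin_smul_right (A := Col (Fin k.n) (Fin l.n)) (B := Col (Fin l.n) (Fin m.n))
    (C := Col (Fin k.n) (Fin m.n)) (colComp t) f r g

/-- The morphism given by a coloured partition. -/
noncomputable def Par.ofCol (t : ℂ) {k l : ℕ} (P : Col (Fin k) (Fin l)) :
    (⟨k⟩ : Par t) ⟶ ⟨l⟩ := Finsupp.single P (1 : ℂ)

/-- The tensor product of morphisms: the bilinear extension of horizontal concatenation. -/
noncomputable def Par.tensor {t : ℂ} {k l k' l' : ℕ} : ((⟨k⟩ : Par t) ⟶ ⟨l⟩) →ₗ[ℂ]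
    ((⟨k'⟩ : Par t) ⟶ ⟨l'⟩) →ₗ[ℂ] ((⟨k + k'⟩ : Par t) ⟶ ⟨l + l'⟩) :=
  bilin fun P Q => Finsupp.single (hconcat P Q) 1

/-- The idempotent `e' = (1 - s) / 2` of `[1]`, where `s` is the strand with label `-1`. -/
noncomputable def signIdem (t : ℂ) : (⟨1⟩ : Par t) ⟶ ⟨1⟩ :=
  (1 / 2 : ℂ) • (Par.ofCol t (strand fun _ => 1) - Par.ofCol t (strand fun _ => -1))

/-- The tensor powers of the idempotent `e'`. -/
noncomputable def signIdemPow (t : ℂ) : ∀ k : ℕ, (⟨k⟩ : Par t) ⟶ ⟨k⟩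
  | 0 => 𝟙 _
  | k + 1 => Par.tensor (signIdemPow t k) (signIdem t)

/-- The inclusion of `{1, -1}` into the complex numbers. -/
noncomputable def sgn : ℤˣ →* ℂ := (Int.castRingHom ℂ).toMonoidHom.comp (Units.coeHom ℤ)

theorem sgn_neg (a : ℤˣ) : sgn (-a) = -sgn a := by simp [sgn]

theorem sgn_mul_self (a : ℤˣ) : sgn a * sgn a = 1 := by
  rw [← map_mul, Int.units_mul_self, map_one]

theorem signIdemPow_eq (t : ℂ) (k : ℕ) : signIdemPow t k =
    (1 / 2 : ℂ) ^ k • ∑ z : Fin k → ℤˣ, sgn (∏ i, z i) • Par.ofCol t (strand z) := by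
  induction k with
  | zero =>
    simp only [pow_zero, one_smul, Finset.univ_unique, Finset.sum_singleton, signIdemPow]
    have h : ∀ z : Fin 0 → ℤˣ, Col.mk (idPart (Fin 0)) 1 = strand z := fun z =>
      congrArg _ (by ext (a | a) <;> exact a.elim0)
    simp only [Finset.univ_eq_empty, Finset.prod_empty, map_one, one_smul]
    exact congrArg (fun a => Finsupp.single a (1 : ℂ)) (h _)
  | succ k ih =>
    have ht : ∀ (z : Fin k → ℤˣ) (s : ℤˣ), Par.tensor (Par.ofCol t (strand z))
        (Par.ofCol t (strand fun _ : Fin 1 => s)) = Par.ofCol t (strand (Fin.snoc z s)) := by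
      intro z s
      have h1 : Sum.elim z (fun _ : Fin 1 => s) ∘ finSumFinEquiv.symm = Fin.snoc z s := by
        ext i
        refine Fin.lastCases ?_ (fun i => ?_) i
        · rw [Fin.snoc_last, Function.comp, finSumFinEquiv_symm_last]; rfl
        · rw [Fin.snoc_castSucc, Function.comp,
            show i.castSucc = Fin.castAdd 1 i from rfl, finSumFinEquiv_symm_apply_castAdd]; rfl
      have h2 : hconcat (strand z) (strand fun _ : Fin 1 => s) = strand (Fin.snoc z s) := by
        rw [hconcat_strand, h1]
      refine (bilin_single _ _ _ _ _).trans ?_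
      rw [h2, mul_one, one_smul]
      rfl
    have hs : ∀ f : (Fin (k + 1) → ℤˣ) → ((⟨k + 1⟩ : Par t) ⟶ ⟨k + 1⟩), ∑ z, f z =
        ∑ z : Fin k → ℤˣ, (f (Fin.snoc z 1) + f (Fin.snoc z (-1))) := by
      intro f
      rw [← (Fin.snocEquiv fun _ : Fin (k + 1) => ℤˣ).sum_comp, Fintype.sum_prod_type,
        Finset.sum_comm]
      refine Finset.sum_congr rfl fun z _ => ?_
      rw [show (Finset.univ : Finset ℤˣ) = {1, -1} from rfl, Finset.sum_pair (by decide)]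
      rfl
    rw [signIdemPow, ih, signIdem, hs]
    simp only [map_smul, map_sum, LinearMap.smul_apply, LinearMap.sum_apply, map_sub, ht,
      Fin.prod_univ_castSucc, Fin.snoc_castSucc, Fin.snoc_last,
      mul_one, mul_neg, pow_succ, mul_smul, Finset.smul_sum]
    rw [← Finset.sum_sub_distrib, Finset.smul_sum]
    refine Finset.sum_congr rfl fun z _ => ?_
    rw [sgn_neg, neg_smul, ← sub_eq_add_neg, ← smul_sub, smul_comm (1 / 2 : ℂ)]

theorem ofCol_comp (t : ℂ) {k l m : ℕ} (P : Col (Fin k) (Fin l)) (Q : Col (Fin l) (Fin m)) :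
    Par.ofCol t P ≫ Par.ofCol t Q =
      (colMul P Q).elim 0 fun U => t ^ loops P.part Q.part • Par.ofCol t U := by
  refine (bilin_single _ _ _ _ _).trans ?_
  rw [mul_one, one_smul, colComp]
  rcases colMul P Q with _ | U
  · rfl
  · refine Eq.trans ?_ (Finsupp.smul_single _ _ _).symm
    rw [smul_eq_mul, mul_one]
    rfl

theorem strand_comp (t : ℂ) {k l : ℕ} (z : Fin k → ℤˣ) (p : Setoid (Fin k ⊕ Fin l))
    (w : Fin k ⊕ Fin l → ℤˣ) : Par.ofCol t (strand z) ≫ Par.ofCol t (Col.mk p w) =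
      Par.ofCol t (Col.mk p (Sum.elim (z * (w ∘ Sum.inl)) (w ∘ Sum.inr))) := by
  rw [ofCol_comp, strand_colMul, Option.elim,
    show loops (strand z).part (Col.mk p w).part = 0 from (id_vcomp p).1, pow_zero, one_smul]

theorem comp_strand (t : ℂ) {k l : ℕ} (z : Fin l → ℤˣ) (p : Setoid (Fin k ⊕ Fin l))
    (w : Fin k ⊕ Fin l → ℤˣ) : Par.ofCol t (Col.mk p w) ≫ Par.ofCol t (strand z) =
      Par.ofCol t (Col.mk p (Sum.elim (w ∘ Sum.inl) (z * (w ∘ Sum.inr)))) := by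
  rw [ofCol_comp, colMul_strand, Option.elim,
    show loops (Col.mk p w).part (strand z).part = 0 from (vcomp_id p).1, pow_zero, one_smul]

theorem strand_comp_strand (t : ℂ) {k : ℕ} (z w : Fin k → ℤˣ) :
    Par.ofCol t (strand z) ≫ Par.ofCol t (strand w) = Par.ofCol t (strand (z * w)) :=
  strand_comp t z _ _

theorem signIdemPow_comp_strand (t : ℂ) {k : ℕ} (w : Fin k → ℤˣ) :
    signIdemPow t k ≫ Par.ofCol t (strand w) = sgn (∏ i, w i) • signIdemPow t k := by
  rw [signIdemPow_eq, Linear.smul_comp, Preadditive.sum_comp, smul_comm]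
  congr 1
  rw [Finset.smul_sum]
  refine Fintype.sum_equiv (Equiv.mulRight w) _ _ fun z => ?_
  rw [Linear.smul_comp, strand_comp_strand, smul_smul]
  congr 1
  simp only [Equiv.coe_mulRight, Pi.mul_apply, Finset.prod_mul_distrib, map_mul]
  rw [mul_left_comm, sgn_mul_self, mul_one]

theorem strand_comp_signIdemPow (t : ℂ) {k : ℕ} (w : Fin k → ℤˣ) :
    Par.ofCol t (strand w) ≫ signIdemPow t k = sgn (∏ i, w i) • signIdemPow t k := by
  rw [← signIdemPow_comp_strand, signIdemPow_eq, Linear.smul_comp, Linear.comp_smul,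
    Preadditive.sum_comp, Preadditive.comp_sum]
  congr 1
  refine Finset.sum_congr rfl fun z _ => ?_
  rw [Linear.smul_comp, Linear.comp_smul, strand_comp_strand, strand_comp_strand, mul_comm]

theorem signIdemPow_idem (t : ℂ) (k : ℕ) : signIdemPow t k ≫ signIdemPow t k = signIdemPow t k := by
  conv_lhs => rhs; rw [signIdemPow_eq]
  rw [Linear.comp_smul, Preadditive.comp_sum]
  simp only [Linear.comp_smul, signIdemPow_comp_strand, smul_smul, sgn_mul_self, one_smul]
  rw [Finset.sum_const, Finset.card_univ, Fintype.card_fun, Fintype.card_fin,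
    show Fintype.card ℤˣ = 2 from rfl, ← Nat.cast_smul_eq_nsmul ℂ, smul_smul, Nat.cast_pow,
    Nat.cast_ofNat, ← mul_pow]
  norm_num

/-- Labels can be moved into the idempotents. -/
theorem sandwich_eq (t : ℂ) {k l : ℕ} (p : Setoid (Fin k ⊕ Fin l)) (w : Fin k ⊕ Fin l → ℤˣ) :
    signIdemPow t k ≫ Par.ofCol t (Col.mk p w) ≫ signIdemPow t l =
      sgn (∏ v, w v) • (signIdemPow t k ≫ Par.ofCol t (Col.mk p 1) ≫ signIdemPow t l) := by
  have h : Par.ofCol t (Col.mk p w) = Par.ofCol t (strand (w ∘ Sum.inl)) ≫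
      Par.ofCol t (Col.mk p 1) ≫ Par.ofCol t (strand (w ∘ Sum.inr)) := by
    rw [comp_strand, strand_comp]
    congr 2
    ext (a | a) <;> simp
  rw [h, Category.assoc, Category.assoc, strand_comp_signIdemPow, ← Category.assoc,
    signIdemPow_comp_strand, Linear.comp_smul, Linear.comp_smul, Linear.smul_comp, smul_smul,
    Fintype.prod_sum_type, map_mul, mul_comm]
  rfl

/-- The key computation for the compatibility of `Ω₀` with composition. -/
theorem sandwich_comp (t : ℂ) {k l m : ℕ} (p : EvenPart k l) (q : EvenPart l m) :
    (signIdemPow t k ≫ Par.ofCol t (Col.mk p.1 1) ≫ signIdemPow t l) ≫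
      (signIdemPow t l ≫ Par.ofCol t (Col.mk q.1 1) ≫ signIdemPow t m) =
    ((1 / 2 : ℂ) ^ l * Nat.card (midHom p.1 q.1).range * t ^ loops p.1 q.1) •
      (signIdemPow t k ≫ Par.ofCol t (Col.mk (vcomp p.1 q.1) 1) ≫ signIdemPow t m) := by
  classical
  have h1 : ∀ v : Fin l → ℤˣ, signIdemPow t k ≫ (Par.ofCol t (Col.mk p.1 1) ≫
      (sgn (∏ i, v i) • Par.ofCol t (strand v)) ≫ Par.ofCol t (Col.mk q.1 1)) ≫ signIdemPow t m =
      (if v ∈ (midHom p.1 q.1).range then t ^ loops p.1 q.1 else 0) •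
        (signIdemPow t k ≫ Par.ofCol t (Col.mk (vcomp p.1 q.1) 1) ≫ signIdemPow t m) := by
    intro v
    rw [Linear.smul_comp, Linear.comp_smul, strand_comp]
    split_ifs with hv
    · obtain ⟨⟨a, b⟩, rfl⟩ := hv
      have hc : ConstOn p.1 fun u => a (Quotient.mk _ u) := fun u u' h =>
        congrArg a (Quotient.sound h)
      have hd : ConstOn q.1 fun u => b (Quotient.mk _ u) := fun u u' h =>
        congrArg b (Quotient.sound h)
      have hc1 := (isEven_iff _).1 p.2 _ hc
      have hd1 := (isEven_iff _).1 q.2 _ hd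
      let c : Fin k ⊕ Fin l ⊕ Fin m → ℤˣ := Sum.elim (fun x => a (Quotient.mk _ (Sum.inl x)))
        (Sum.elim (fun y => a (Quotient.mk _ (Sum.inr y))) fun z => b (Quotient.mk _ (Sum.inr z)))
      have e1 : Col.mk p.1 1 = Col.mk p.1 (c ∘ lowerRows) :=
        Col.mk_eq.2 ⟨_, hc, by rintro (x | y) <;> exact (mul_one _).symm⟩
      have e2 : Col.mk q.1 (Sum.elim (midHom p.1 q.1 (a, b) * ((1 : Fin l ⊕ Fin m → ℤˣ) ∘ Sum.inl)) ((1 : Fin l ⊕ Fin m → ℤˣ) ∘ Sum.inr)) =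
          Col.mk q.1 (c ∘ Sum.inr) := by
        refine Col.mk_eq.2 ⟨_, hd, ?_⟩
        rintro (y | z)
        · change a _ = b _ * ((a _ * b _) * 1)
          rw [mul_one, mul_left_comm, Int.units_mul_self, mul_one]
        · exact (mul_one _).symm
      rw [e1, e2, ofCol_comp, colMul_mk, Option.elim, Linear.smul_comp, Linear.comp_smul,
        Linear.smul_comp, Linear.comp_smul, sandwich_eq t (vcomp p.1 q.1) (c ∘ outerRows), smul_smul, smul_smul,
        show loops (Col.mk p.1 (c ∘ lowerRows)).part (Col.mk q.1 (c ∘ Sum.inr)).part =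
          loops p.1 q.1 from rfl, mul_right_comm, ← map_mul]
      have h2 : (∏ i, midHom p.1 q.1 (a, b) i) * ∏ v, (c ∘ outerRows) v = 1 := by
        rw [Fintype.prod_sum_type] at hc1 hd1 ⊢
        rw [show (∏ i, midHom p.1 q.1 (a, b) i) = (∏ i, a (Quotient.mk _ (Sum.inr i))) *
          ∏ i, b (Quotient.mk _ (Sum.inl i)) from Finset.prod_mul_distrib]
        have h3 := congrArg₂ (· * ·) hc1 hd1
        simp only [mul_one] at h3
        refine Eq.trans ?_ h3
        rw [mul_mul_mul_comm]
        congr 1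
        exact mul_comm _ _
      rw [h2, map_one, one_mul]
    · have h2 : colMul (Col.mk p.1 1) (Col.mk q.1 (Sum.elim (v * ((1 : Fin l ⊕ Fin m → ℤˣ) ∘ Sum.inl))
          ((1 : Fin l ⊕ Fin m → ℤˣ) ∘ Sum.inr))) = none := by
        rcases colMul_cases (Col.mk p.1 1) (Col.mk q.1 (Sum.elim (v * ((1 : Fin l ⊕ Fin m → ℤˣ) ∘ Sum.inl))
          ((1 : Fin l ⊕ Fin m → ℤˣ) ∘ Sum.inr))) with ⟨p', q', c, h3, h4⟩ | h2
        · exfalso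
          obtain rfl := Col.mk_eq' h3
          obtain rfl := Col.mk_eq' h4
          obtain ⟨g, hg, hg'⟩ := Col.mk_eq.1 h3
          obtain ⟨f, hf, hf'⟩ := Col.mk_eq.1 h4
          refine hv ⟨(Quotient.lift g hg, Quotient.lift f hf), ?_⟩
          funext y
          have h5 : c (Sum.inr (Sum.inl y)) = g (Sum.inr y) * 1 := hg' (Sum.inr y)
          have h6 : c (Sum.inr (Sum.inl y)) = f (Sum.inl y) * (v y * 1) := hf' (Sum.inl y)
          change g (Sum.inr y) * f (Sum.inl y) = v y
          rw [mul_one] at h5 h6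
          rw [← h5, h6, mul_right_comm, Int.units_mul_self, one_mul]
        · exact h2.1
      rw [ofCol_comp, h2, Option.elim, smul_zero, Limits.zero_comp, Limits.comp_zero, zero_smul]
  have h2 : ∀ f : (⟨k⟩ : Par t) ⟶ ⟨l⟩, ∀ g : (⟨l⟩ : Par t) ⟶ ⟨m⟩,
      (signIdemPow t k ≫ f ≫ signIdemPow t l) ≫ (signIdemPow t l ≫ g ≫ signIdemPow t m) =
      (1 / 2 : ℂ) ^ l • ∑ v : Fin l → ℤˣ, signIdemPow t k ≫ (f ≫
        (sgn (∏ i, v i) • Par.ofCol t (strand v)) ≫ g) ≫ signIdemPow t m := by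
    intro f g
    have h3 : (signIdemPow t k ≫ f ≫ signIdemPow t l) ≫ (signIdemPow t l ≫ g ≫ signIdemPow t m) =
        signIdemPow t k ≫ (f ≫ (signIdemPow t l ≫ signIdemPow t l) ≫ g) ≫ signIdemPow t m := by
      simp only [Category.assoc]
    rw [h3, signIdemPow_idem]
    conv_lhs => rw [signIdemPow_eq t l]
    rw [Linear.smul_comp, Preadditive.sum_comp, Linear.comp_smul, Preadditive.comp_sum,
      Linear.smul_comp, Preadditive.sum_comp, Linear.comp_smul, Preadditive.comp_sum]
  rw [h2, Finset.sum_congr rfl fun v _ => h1 v, ← Finset.sum_smul, smul_smul, Finset.sum_ite,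
    Finset.sum_const_zero, add_zero, Finset.sum_const, nsmul_eq_mul, mul_assoc,
    ← Fintype.card_subtype, ← Nat.card_eq_fintype_card]

/-- The image `2 ^ ((k + l) / 2 - s) e'^{⊗l} p e'^{⊗k}` of an even partition `p` with `s` blocks. -/
noncomputable def omegaPart (t : ℂ) {k l : ℕ} (p : EvenPart k l) :
    (⟨k⟩ : Par (2 * t)) ⟶ ⟨l⟩ :=
  (2 : ℂ) ^ (((k + l : ℤ) - 2 * Nat.card (Quotient p.1)) / 2) •
    (signIdemPow (2 * t) k ≫ Par.ofCol (2 * t) (Col.mk p.1 1) ≫ signIdemPow (2 * t) l)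

/-- The linear extension of `omegaPart`. -/
noncomputable def omegaMap {t : ℂ} {X Y : RepZero t} :
    (X ⟶ Y) →ₗ[ℂ] ((⟨X.n⟩ : Par (2 * t)) ⟶ ⟨Y.n⟩) :=
  Finsupp.linearCombination ℂ fun p : EvenPart X.n Y.n => omegaPart t p

theorem omegaMap_ofPart (t : ℂ) {k l : ℕ} (p : EvenPart k l) :
    omegaMap (RepZero.ofPart t p) = omegaPart t p :=
  (Finsupp.linearCombination_single _ _ _).trans (one_smul _ _)

theorem IsEven.even_card {k l : ℕ} {p : Setoid (Fin k ⊕ Fin l)} (h : IsEven p) :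
    Even (k + l) := by
  have h1 := (isEven_iff p).1 h (fun _ => -1) fun _ _ _ => rfl
  rw [Finset.prod_const, Finset.card_univ, Fintype.card_sum, Fintype.card_fin,
    Fintype.card_fin] at h1
  by_contra h2
  rw [Nat.not_even_iff_odd] at h2
  rw [h2.neg_one_pow] at h1
  exact absurd h1 (by decide)

theorem omegaPart_comp (t : ℂ) {k l m : ℕ} (p : EvenPart k l) (q : EvenPart l m) :
    omegaPart t p ≫ omegaPart t q =
      t ^ loops p.1 q.1 • omegaPart t ⟨vcomp p.1 q.1, p.2.vcomp q.2⟩ := by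
  unfold omegaPart
  rw [Linear.smul_comp, Linear.comp_smul, sandwich_comp, smul_smul, smul_smul, smul_smul]
  congr 1
  have h1 := congrArg (Nat.cast (R := ℂ)) (card_range_midHom p.1 q.1)
  have h2 := card_stack p.1 q.1
  obtain ⟨a, ha⟩ := p.2.even_card
  obtain ⟨b, hb⟩ := q.2.even_card
  generalize Nat.card (midHom p.1 q.1).range = N at *
  rw [h2] at h1
  clear h2
  dsimp only
  generalize Nat.card (Quotient p.1) = x at *
  generalize Nat.card (Quotient q.1) = y at *
  generalize Nat.card (Quotient (vcomp p.1 q.1)) = z at *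
  generalize loops p.1 q.1 = w at *
  push_cast at h1
  have h3 : (N : ℂ) = (2 : ℂ) ^ ((x : ℤ) + y - z - w) := by
    rw [zpow_sub₀ two_ne_zero, zpow_sub₀ two_ne_zero, div_div, ← zpow_add₀ two_ne_zero,
      eq_div_iff (zpow_ne_zero _ two_ne_zero)]
    exact_mod_cast h1
  have h4 : (1 / 2 : ℂ) ^ l = (2 : ℂ) ^ (-l : ℤ) := by simp
  rw [h3, h4, mul_pow, ← zpow_natCast (2 : ℂ) w,
    show (2 : ℂ) ^ (((k : ℤ) + l - 2 * x) / 2) * (2 : ℂ) ^ (((l : ℤ) + m - 2 * y) / 2) *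
      ((2 : ℂ) ^ (-l : ℤ) * (2 : ℂ) ^ ((x : ℤ) + y - z - w) * ((2 : ℂ) ^ (w : ℤ) * t ^ w)) =
      t ^ w * ((2 : ℂ) ^ (((k : ℤ) + l - 2 * x) / 2) * (2 : ℂ) ^ (((l : ℤ) + m - 2 * y) / 2) *
      (2 : ℂ) ^ (-l : ℤ) * (2 : ℂ) ^ ((x : ℤ) + y - z - w) * (2 : ℂ) ^ (w : ℤ)) by ring,
    ← zpow_add₀ two_ne_zero, ← zpow_add₀ two_ne_zero, ← zpow_add₀ two_ne_zero,
    ← zpow_add₀ two_ne_zero]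
  congr 2
  omega

theorem omegaMap_comp {t : ℂ} {X Y Z : RepZero t} (f : X ⟶ Y) (g : Y ⟶ Z) :
    omegaMap (f ≫ g) = omegaMap f ≫ omegaMap g := by
  obtain ⟨k⟩ := X
  obtain ⟨l⟩ := Y
  obtain ⟨m⟩ := Z
  have h : ∀ (p : EvenPart k l) (q : EvenPart l m), omegaMap (RepZero.ofPart t p ≫
      RepZero.ofPart t q) = omegaPart t p ≫ omegaPart t q := by
    intro p q
    rw [omegaPart_comp, ← omegaMap_ofPart, ← map_smul]
    congr 1
    refine (bilin_single _ _ _ _ _).trans ?_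
    rw [mul_one, one_smul]
    refine Eq.trans ?_ (Finsupp.smul_single _ _ _).symm
    rw [smul_eq_mul, mul_one]
    rfl
  induction f using RepZero.hom_induction with
  | zero => rw [Limits.zero_comp, map_zero, map_zero, Limits.zero_comp]
  | plus f f' hf hf' =>
    rw [Preadditive.add_comp, map_add, map_add, Preadditive.add_comp, hf, hf']
  | smul r p =>
    induction g using RepZero.hom_induction with
    | zero => rw [Limits.comp_zero, map_zero, map_zero, Limits.comp_zero]
    | plus g g' hg hg' =>
      rw [Preadditive.comp_add, map_add, map_add, Preadditive.comp_add, hg, hg']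
    | smul s q =>
      rw [Linear.smul_comp, Linear.comp_smul, map_smul, map_smul, map_smul, map_smul, h,
        Linear.smul_comp, Linear.comp_smul, omegaMap_ofPart, omegaMap_ofPart]

theorem omegaMap_id (t : ℂ) (k : ℕ) :
    omegaMap (𝟙 (⟨k⟩ : RepZero t)) = signIdemPow (2 * t) k := by
  refine (omegaMap_ofPart t ⟨idPart (Fin k), isEven_idPart _⟩).trans ?_
  have h : Nat.card (Quotient (idPart (Fin k))) = k := by
    have e : Quotient (idPart (Fin k)) ≃ Fin k :=
      Setoid.quotientKerEquivOfSurjective _ fun a => ⟨Sum.inl a, rfl⟩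
    rw [Nat.card_congr e, Nat.card_fin]
  have h2 : Par.ofCol (2 * t) (Col.mk (idPart (Fin k)) 1) = 𝟙 _ := rfl
  simp only [omegaPart]
  rw [h, h2, Category.id_comp, signIdemPow_idem, ← two_mul, sub_self, Int.zero_ediv, zpow_zero,
    one_smul]

/-- The formal direct sum of the `[k_i]`, for a formal direct sum of the `[k_i]` in `Rep₀(H_t)`. -/
def omegaObj {t : ℂ} (M : Mat_ (RepZero t)) : Mat_ (Par (2 * t)) := ⟨M.ι, fun i => ⟨(M.X i).n⟩⟩

/-- Entrywise application of `omegaMap` to a matrix of morphisms. -/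
noncomputable def omegaMat {t : ℂ} {M N : Mat_ (RepZero t)} (f : M ⟶ N) :
    omegaObj M ⟶ omegaObj N := fun i j => omegaMap (f i j)

theorem omegaMat_comp {t : ℂ} {M N K : Mat_ (RepZero t)} (f : M ⟶ N) (g : N ⟶ K) :
    omegaMat (f ≫ g) = omegaMat f ≫ omegaMat g := by
  refine Mat_.hom_ext _ _ fun i j => ?_
  refine (congrArg omegaMap (Mat_.comp_apply f g i j)).trans ?_
  rw [map_sum]
  exact Finset.sum_congr rfl fun _ _ => omegaMap_comp _ _

/-- The functor `Ω : Rep(H_t) ⥤ Par(ℤ₂, 2t)^Kar`, which is given by `[k] ↦ ([k], e'^{⊗k})` and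
`omegaMap` on `Rep₀(H_t)`. -/
noncomputable def Omega (t : ℂ) :
    Idempotents.Karoubi (Mat_ (RepZero t)) ⥤ Idempotents.Karoubi (Mat_ (Par (2 * t))) where
  obj P := ⟨omegaObj P.X, omegaMat P.p, by rw [← omegaMat_comp, P.idem]⟩
  map f := ⟨omegaMat f.f, by
    change omegaMat _ ≫ omegaMat _ ≫ omegaMat _ = _
    rw [← omegaMat_comp, ← omegaMat_comp, f.comm]⟩
  map_id P := rfl
  map_comp f g := Idempotents.Karoubi.hom_ext _ _ (omegaMat_comp f.f g.f)

end Categories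
section Linear

noncomputable instance (C : Type*) [Category C] [Preadditive C] [Linear ℂ C] :
    Linear ℂ (Mat_ C) where
  homModule M N := inferInstanceAs (Module ℂ (∀ (i : M.ι) (j : N.ι), M.X i ⟶ N.X j))
  smul_comp M N K r f g := by
    refine Mat_.hom_ext _ _ fun i j => ?_
    change ∑ x, (r • f i x) ≫ g x j = r • ∑ x, f i x ≫ g x j
    simp only [Linear.smul_comp, Finset.smul_sum]
  comp_smul M N K f r g := by
    refine Mat_.hom_ext _ _ fun i j => ?_
    change ∑ x, f i x ≫ (r • g x j) = r • ∑ x, f i x ≫ g x j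
    simp only [Linear.comp_smul, Finset.smul_sum]

instance (C : Type*) [Category C] [Preadditive C] [Linear ℂ C] (P Q : Idempotents.Karoubi C) :
    Module ℂ (P ⟶ Q) where
  smul r f := ⟨r • f.f, by rw [Linear.smul_comp, Linear.comp_smul, f.comm]⟩
  one_smul _ := Idempotents.Karoubi.hom_ext _ _ (one_smul _ _)
  mul_smul _ _ _ := Idempotents.Karoubi.hom_ext _ _ (mul_smul _ _ _)
  smul_zero _ := Idempotents.Karoubi.hom_ext _ _ (smul_zero _)
  smul_add _ _ _ := Idempotents.Karoubi.hom_ext _ _ (smul_add _ _ _)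
  add_smul _ _ _ := Idempotents.Karoubi.hom_ext _ _ (add_smul _ _ _)
  zero_smul _ := Idempotents.Karoubi.hom_ext _ _ (zero_smul _ _)

instance (C : Type*) [Category C] [Preadditive C] [Linear ℂ C] :
    Linear ℂ (Idempotents.Karoubi C) where
  homModule _ _ := inferInstance
  smul_comp _ _ _ _ _ _ := Idempotents.Karoubi.hom_ext _ _ (Linear.smul_comp _ _ _ _ _ _)
  comp_smul _ _ _ _ _ _ := Idempotents.Karoubi.hom_ext _ _ (Linear.comp_smul _ _ _ _ _ _)

end Linear

section Reps

/-- The hyperoctahedral group `H_n = ℤ₂^n ⋊ S_n`, where `S_n` permutes the coordinates. -/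
abbrev Hyp (n : ℕ) : Type := (Fin n → ℤˣ) ⋊[mulAutArrow] Equiv.Perm (Fin n)

/-- The reflection representation `u` of `H_n`. -/
noncomputable def reflRep (n : ℕ) : Representation ℂ (Hyp n) (Fin n → ℂ) where
  toFun g :=
    { toFun := fun c i => sgn (g.left i) * c (g.right.symm i)
      map_add' := fun c d => by ext i; simp [mul_add]
      map_smul' := fun r c => by ext i; simp [mul_left_comm] }
  map_one' := by
    refine LinearMap.ext fun c => funext fun i => ?_
    change sgn 1 * c i = c i
    rw [map_one, one_mul]
  map_mul' g h := by
    refine LinearMap.ext fun c => funext fun i => ?_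
    change sgn (g.left i * h.left (g.right.symm i)) * c (h.right.symm (g.right.symm i)) =
      sgn (g.left i) * (sgn (h.left (g.right.symm i)) * c (h.right.symm (g.right.symm i)))
    rw [map_mul, mul_assoc]

/-- The permutation representation `V` of `H_n`; the basis vector `e_j^i` is sent to
`e_{a_{σ(i)} j}^{σ(i)}`. -/
noncomputable def permRep (n : ℕ) : Representation ℂ (Hyp n) (Fin n × ℤˣ → ℂ) where
  toFun g :=
    { toFun := fun c v => c (g.right.symm v.1, g.left v.1 * v.2)
      map_add' := fun c d => rfl
      map_smul' := fun r c => rfl }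
  map_one' := by
    refine LinearMap.ext fun c => funext fun v => ?_
    change c (v.1, 1 * v.2) = c v
    rw [one_mul]
  map_mul' g h := by
    refine LinearMap.ext fun c => funext fun v => ?_
    change c (h.right.symm (g.right.symm v.1), (g.left v.1 * h.left (g.right.symm v.1)) * v.2) =
      c (h.right.symm (g.right.symm v.1), h.left (g.right.symm v.1) * (g.left v.1 * v.2))
    congr 2
    rw [mul_comm (g.left v.1), mul_assoc]

open scoped TensorProduct

/-- The `k`-th tensor power of a representation. -/
noncomputable def tensorPow {G V : Type} [Group G] [AddCommGroup V] [Module ℂ V]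
    (ρ : Representation ℂ G V) (k : ℕ) : Representation ℂ G (⨂[ℂ] _ : Fin k, V) :=
  PiTensorProduct.mapMonoidHom.comp (MonoidHom.pi fun _ => ρ)

/-- The standard basis of the `k`-th tensor power of `ℂ^I`. -/
noncomputable def tensorBasis (I : Type) [Finite I] (k : ℕ) :
    Module.Basis (Fin k → I) ℂ (⨂[ℂ] _ : Fin k, (I → ℂ)) :=
  Basis.piTensorProduct fun _ => Pi.basisFun ℂ I

/-- The linear map between tensor powers of `ℂ^I` with a given matrix. -/
noncomputable def tensorMap {I : Type} [Fintype I] [DecidableEq I] {k l : ℕ}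
    (M : Matrix (Fin l → I) (Fin k → I) ℂ) :
    (⨂[ℂ] _ : Fin k, (I → ℂ)) →ₗ[ℂ] ⨂[ℂ] _ : Fin l, (I → ℂ) :=
  Matrix.toLin (tensorBasis I k) (tensorBasis I l) M

/-- Matrices which are compatible with a monomial action give maps of representations. -/
theorem tensorMap_comm {I G : Type} [Fintype I] [DecidableEq I] [Group G] {k l : ℕ}
    (M : Matrix (Fin l → I) (Fin k → I) ℂ) (ρ : Representation ℂ G (I → ℂ)) (g : G)
    (π : Equiv.Perm I) (χ : I → ℂ)
    (hρ : ∀ i, ρ g (Pi.single i 1) = χ i • Pi.single (π i) 1)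
    (hM : ∀ (y : Fin l → I) (x : Fin k → I),
      M (π ∘ y) (π ∘ x) * (∏ a, χ (x a)) = M y x * ∏ a, χ (y a)) :
    tensorMap M ∘ₗ tensorPow ρ k g = tensorPow ρ l g ∘ₗ tensorMap M := by
  have h1 : ∀ (m : ℕ) (x : Fin m → I), tensorPow ρ m g (tensorBasis I m x) =
      (∏ a, χ (x a)) • tensorBasis I m (π ∘ x) := by
    intro m x
    simp only [tensorBasis, Basis.piTensorProduct_apply, Pi.basisFun_apply]
    refine (PiTensorProduct.map_tprod _ _).trans ?_
    rw [← MultilinearMap.map_smul_univ]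
    exact congrArg _ (funext fun a => hρ (x a))
  refine (tensorBasis I k).ext fun x => ?_
  rw [LinearMap.comp_apply, LinearMap.comp_apply, h1, map_smul, tensorMap, Matrix.toLin_self,
    Matrix.toLin_self, map_sum, Finset.smul_sum,
    ← (Equiv.arrowCongr (Equiv.refl (Fin l)) π).sum_comp]
  refine Finset.sum_congr rfl fun y _ => ?_
  rw [map_smul, h1, smul_smul, smul_smul, ← hM, mul_comm]
  rfl

/-- The `k`-th tensor power of a representation on `ℂ^I`, as an object of the category of finite
dimensional representations. -/
noncomputable abbrev tensorObj {I G : Type} [Fintype I] [Group G]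
    (ρ : Representation ℂ G (I → ℂ)) (k : ℕ) : FDRep ℂ G := FDRep.of (tensorPow ρ k)

/-- The morphism of representations given by a linear map which commutes with the action. -/
noncomputable def tensorHom {I G : Type} [Fintype I] [Group G]
    (ρ : Representation ℂ G (I → ℂ)) {k l : ℕ}
    (f : (⨂[ℂ] _ : Fin k, (I → ℂ)) →ₗ[ℂ] ⨂[ℂ] _ : Fin l, (I → ℂ))
    (h : ∀ g, f ∘ₗ tensorPow ρ k g = tensorPow ρ l g ∘ₗ f) : tensorObj ρ k ⟶ tensorObj ρ l where
  hom := InducedCategory.homMk (ModuleCat.ofHom f)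
  comm g := by
    apply InducedCategory.hom_ext
    exact ModuleCat.hom_ext (h g)

theorem kern_refl (n : ℕ) {k l : ℕ} (p : EvenPart k l) (g : Hyp n) :
    tensorMap (kern (Fin n) ℂ p.1) ∘ₗ tensorPow (reflRep n) k g =
      tensorPow (reflRep n) l g ∘ₗ tensorMap (kern (Fin n) ℂ p.1) := by
  refine tensorMap_comm _ _ g g.right (fun i => sgn (g.left (g.right i))) (fun i => ?_)
    fun y x => ?_
  · funext j
    change sgn (g.left j) * (Pi.single i 1 : Fin n → ℂ) (g.right.symm j) =
      sgn (g.left (g.right i)) * (Pi.single (g.right i) 1 : Fin n → ℂ) j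
    by_cases h : j = g.right i
    · subst h
      simp
    · rw [Pi.single_eq_of_ne h, Pi.single_eq_of_ne fun h' => h (by rw [← h']; simp), mul_zero,
        mul_zero]
  · have h1 : ConstOn p.1 (Sum.elim (g.right ∘ x) (g.right ∘ y)) ↔ ConstOn p.1 (Sum.elim x y) := by
      rw [← Sum.comp_elim]
      exact forall₃_congr fun a b _ => g.right.injective.eq_iff
    have h3 : kern (Fin n) ℂ p.1 (g.right ∘ y) (g.right ∘ x) = kern (Fin n) ℂ p.1 y x := by
      exact congrArg (fun P : Prop => @ite ℂ P (Classical.propDecidable P) 1 0) (propext h1)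
    rw [h3, kern]
    split_ifs with h
    · have h2 := (isEven_iff p.1).1 p.2
        (fun v => g.left (g.right (Sum.elim x y v))) fun a b hab => by simp only [h a b hab]
      rw [Fintype.prod_sum_type, mul_eq_one_iff_eq_inv, Int.units_inv_eq_self] at h2
      simp only [Sum.elim_inl, Sum.elim_inr] at h2
      rw [one_mul, one_mul, ← map_prod, ← map_prod, h2]
    · rw [zero_mul, zero_mul]

theorem colKern_perm (n : ℕ) {k l : ℕ} (P : Col (Fin k) (Fin l)) (g : Hyp n) :
    tensorMap (colKern (Fin n) ℂ P) ∘ₗ tensorPow (permRep n) k g =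
      tensorPow (permRep n) l g ∘ₗ tensorMap (colKern (Fin n) ℂ P) := by
  let π : Equiv.Perm (Fin n × ℤˣ) :=
    { toFun := fun v => (g.right v.1, g.left (g.right v.1) * v.2)
      invFun := fun v => (g.right.symm v.1, g.left v.1 * v.2)
      left_inv := fun v => by simp [← mul_assoc, Int.units_mul_self]
      right_inv := fun v => by simp [← mul_assoc, Int.units_mul_self] }
  refine tensorMap_comm _ _ g π (fun _ => 1) (fun v => ?_) fun y x => ?_
  · funext w
    rw [one_smul]
    change (Pi.single v 1 : Fin n × ℤˣ → ℂ) (π.symm w) = (Pi.single (π v) 1 : Fin n × ℤˣ → ℂ) w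
    by_cases h : w = π v
    · subst h
      simp
    · rw [Pi.single_eq_of_ne h, Pi.single_eq_of_ne fun h' => h (by rw [← h']; simp)]
  · have h1 : ColConst P (Sum.elim (π ∘ x) (π ∘ y)) ↔ ColConst P (Sum.elim x y) := by
      induction P using Col.ind with | _ p z => ?_
      rw [colConst_mk, colConst_mk, ← Sum.comp_elim]
      refine forall₃_congr fun a b _ => ?_
      simp only [Function.comp, π, Equiv.coe_fn_mk, Prod.mk.injEq, EmbeddingLike.apply_eq_iff_eq]
      refine and_congr_right fun h => ?_
      rw [h, mul_assoc, mul_assoc, mul_right_inj]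
    rw [Finset.prod_const_one, Finset.prod_const_one]
    congr 1
    exact congrArg (fun P : Prop => @ite ℂ P (Classical.propDecidable P) 1 0) (propext h1)

theorem tensorMap_mul {I : Type} [Fintype I] [DecidableEq I] {k l m : ℕ}
    (A : Matrix (Fin m → I) (Fin l → I) ℂ) (B : Matrix (Fin l → I) (Fin k → I) ℂ) :
    tensorMap (A * B) = tensorMap A ∘ₗ tensorMap B := Matrix.toLin_mul _ _ _ _ _

theorem tensorMap_one {I : Type} [Fintype I] [DecidableEq I] {k : ℕ} :
    tensorMap (1 : Matrix (Fin k → I) (Fin k → I) ℂ) = LinearMap.id := Matrix.toLin_one _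

theorem tensorMap_smul {I : Type} [Fintype I] [DecidableEq I] {k l : ℕ} (r : ℂ)
    (A : Matrix (Fin l → I) (Fin k → I) ℂ) : tensorMap (r • A) = r • tensorMap A :=
  map_smul (Matrix.toLin (tensorBasis I k) (tensorBasis I l)) r A

theorem FDRep_hom_ext {G : Type} [Group G] {V W : FDRep ℂ G} {f g : V ⟶ W}
    (h : f.hom.hom.hom = g.hom.hom.hom) : f = g :=
  Action.hom_ext _ _ (InducedCategory.hom_ext (ModuleCat.hom_ext h))

/-- The map `T_p : u^{⊗k} → u^{⊗l}` of an even partition `p`. -/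
noncomputable def reflMap (n : ℕ) {k l : ℕ} (p : EvenPart k l) :
    tensorObj (reflRep n) k ⟶ tensorObj (reflRep n) l :=
  tensorHom (reflRep n) (tensorMap (kern (Fin n) ℂ p.1)) (kern_refl n p)

/-- The map `T_(p,z) : V^{⊗k} → V^{⊗l}` of a coloured partition `(p, z)`. -/
noncomputable def permMap (n : ℕ) {k l : ℕ} (P : Col (Fin k) (Fin l)) :
    tensorObj (permRep n) k ⟶ tensorObj (permRep n) l :=
  tensorHom (permRep n) (tensorMap (colKern (Fin n) ℂ P)) (colKern_perm n P)

theorem reflMap_comp (n : ℕ) {k l m : ℕ} (p : EvenPart k l) (q : EvenPart l m) :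
    reflMap n p ≫ reflMap n q =
      (n : ℂ) ^ loops p.1 q.1 • reflMap n ⟨vcomp p.1 q.1, p.2.vcomp q.2⟩ := by
  apply FDRep_hom_ext
  change tensorMap (kern (Fin n) ℂ q.1) ∘ₗ tensorMap (kern (Fin n) ℂ p.1) =
    (n : ℂ) ^ loops p.1 q.1 • tensorMap (kern (Fin n) ℂ (vcomp p.1 q.1))
  rw [← tensorMap_mul, kern_mul, Fintype.card_fin]
  exact tensorMap_smul _ _

theorem permMap_comp (n : ℕ) {k l m : ℕ} (P : Col (Fin k) (Fin l)) (Q : Col (Fin l) (Fin m)) :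
    permMap n P ≫ permMap n Q = (colMul P Q).elim 0 fun U =>
      (2 * (n : ℂ)) ^ loops P.part Q.part • permMap n U := by
  apply FDRep_hom_ext
  change tensorMap (colKern (Fin n) ℂ Q) ∘ₗ tensorMap (colKern (Fin n) ℂ P) = _
  rw [← tensorMap_mul, colKern_mul, Fintype.card_prod, Fintype.card_fin,
    show Fintype.card ℤˣ = 2 from rfl, mul_comm n, Nat.cast_mul, Nat.cast_ofNat]
  rcases colMul P Q with _ | U
  · exact map_zero (Matrix.toLin (tensorBasis _ k) (tensorBasis _ m))
  · exact tensorMap_smul _ _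

/-- Linear extensions of multiplicative maps on bases are multiplicative. -/
theorem linearCombination_comp {D : Type*} [Category D] [Preadditive D] [Linear ℂ D] {X Y Z : D}
    {A B C : Type} {m : A → B → (C →₀ ℂ)} {φ : A → (X ⟶ Y)} {ψ : B → (Y ⟶ Z)} {θ : C → (X ⟶ Z)}
    (h : ∀ a b, Finsupp.linearCombination ℂ θ (m a b) = φ a ≫ ψ b) (f : A →₀ ℂ) (g : B →₀ ℂ) :
    Finsupp.linearCombination ℂ θ (bilin m f g) =
      Finsupp.linearCombination ℂ φ f ≫ Finsupp.linearCombination ℂ ψ g := by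
  induction f using Finsupp.induction_linear with
  | zero => simp
  | add f f' hf hf' => rw [map_add, LinearMap.add_apply, map_add, hf, hf', map_add,
      Preadditive.add_comp]
  | single a r =>
    induction g using Finsupp.induction_linear with
    | zero => simp
    | add g g' hg hg' => rw [map_add, map_add, hg, hg', map_add, Preadditive.comp_add]
    | single b s =>
      rw [bilin_single, map_smul, h, Finsupp.linearCombination_single,
        Finsupp.linearCombination_single, Linear.smul_comp, Linear.comp_smul, smul_smul]

/-- The functor `G' : Rep₀(H_n) ⥤ Rep(H_n)`, `[k] ↦ u^{⊗k}`, `p ↦ T_p`. -/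
noncomputable def reflFunctor (n : ℕ) : RepZero (n : ℂ) ⥤ FDRep ℂ (Hyp n) where
  obj X := tensorObj (reflRep n) X.n
  map {X Y} f := Finsupp.linearCombination ℂ (fun p : EvenPart X.n Y.n => reflMap n p) f
  map_id X := by
    refine (Finsupp.linearCombination_single _ _ _).trans ?_
    rw [one_smul]
    apply FDRep_hom_ext
    change tensorMap (kern (Fin n) ℂ (idPart (Fin X.n))) = LinearMap.id
    rw [kern_id, tensorMap_one]
  map_comp f g := by
    refine linearCombination_comp (fun p q => ?_) f g
    rw [evenComp, Finsupp.linearCombination_single, reflMap_comp]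

/-- The functor `H' : Par(ℤ₂, 2n) ⥤ Rep(H_n)`, `[k] ↦ V^{⊗k}`, `(p, z) ↦ T_(p,z)`. -/
noncomputable def permFunctor (n : ℕ) : Par (2 * (n : ℂ)) ⥤ FDRep ℂ (Hyp n) where
  obj X := tensorObj (permRep n) X.n
  map {X Y} f := Finsupp.linearCombination ℂ (fun P : Col (Fin X.n) (Fin Y.n) => permMap n P) f
  map_id X := by
    refine (Finsupp.linearCombination_single _ _ _).trans ?_
    rw [one_smul]
    apply FDRep_hom_ext
    change tensorMap (colKern (Fin n) ℂ (Col.mk (idPart (Fin X.n)) 1)) = LinearMap.id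
    rw [← tensorMap_one, ← kern_id _ (Fin n × ℤˣ) ℂ]
    congr 1
    ext y x
    rw [colKern_mk]
    congr 1 <;> ext i <;> simp [twist]
  map_comp f g := by
    refine linearCombination_comp (fun P Q => ?_) f g
    rw [colComp, permMap_comp]
    rcases colMul P Q with _ | U
    · exact map_zero _
    · exact Finsupp.linearCombination_single _ _ _

end Reps
section Extensions

/-- The object `[k]` of the Karoubian envelope. -/
noncomputable def generators (C : Type*) [Category C] [Preadditive C] :
    C ⥤ Idempotents.Karoubi (Mat_ C) :=
  Mat_.embedding C ⋙ Idempotents.toKaroubi (Mat_ C)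

/-- A `ℂ`-linear extension of the functor `F` to the Karoubian envelope of `C`, that is to the
idempotent completion of the additive envelope. -/
structure KarExtension {C D : Type*} [Category C] [Preadditive C] [Linear ℂ C] [Category D]
    [Preadditive D] [Linear ℂ D] (F : C ⥤ D) where
  functor : Idempotents.Karoubi (Mat_ C) ⥤ D
  additive : functor.Additive
  linear : functor.Linear ℂ
  iso : generators C ⋙ functor ≅ F

/-- The inclusion of `Ω([k]) = ([k], e'^{⊗k})` into `[k]`. -/
noncomputable def omegaIncl (t : ℂ) (k : ℕ) :
    (Omega t).obj ((generators (RepZero t)).obj ⟨k⟩) ⟶ (generators (Par (2 * t))).obj ⟨k⟩ :=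
  Idempotents.Karoubi.decompId_i _

/-- For extensions `G` of `G'` and `H` of `H'` and a natural isomorphism `H Ω ≅ G`: the embedding
`u^{⊗k} ≅ G([k]) ≅ H(Ω([k])) → H([k]) ≅ V^{⊗k}`. -/
noncomputable def comparison {n : ℕ} (G : KarExtension (reflFunctor n))
    (H : KarExtension (permFunctor n)) (η : Omega (n : ℂ) ⋙ H.functor ≅ G.functor) (k : ℕ) :
    tensorObj (reflRep n) k ⟶ tensorObj (permRep n) k :=
  G.iso.inv.app ⟨k⟩ ≫ η.inv.app ((generators (RepZero (n : ℂ))).obj ⟨k⟩) ≫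
    H.functor.map (omegaIncl n k) ≫ H.iso.hom.app ⟨k⟩

end Extensions
end Hyperoctahedral

/-! Everything reduces to the generators `[k]` and the idempotents `e'^{⊗k}`, because in a Karoubian
envelope every object is a retract of a finite sum of generators.

`Ω` is fully faithful. A labelled strand composed with `e'^{⊗k}` contributes only its sign, so the
morphisms from `([k], e'^{⊗k})` to `([l], e'^{⊗l})` are spanned by the sandwiches `e'^{⊗l} p
e'^{⊗k}` with all labels `1`. If `p` is not even, some block-constant relabelling has product `-1`;
it does not change the coloured partition but negates the sandwich, which therefore vanishes
(`sandwich_mem_range`). If `p` is even, its sandwich is the normalised signed sum of all labellings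
of `p`, and a signed projection onto even partitions recovers `p` from it; hence these sandwiches
are linearly independent (`omegaMap_injective`).

`Ω` is essentially surjective. The complement `(1 + s)/2` of `e'` in `End([1])` factors through `e'
⊗ e'`: when a strand is doubled, its label occurs twice and the two signs cancel. Doing this
independently on `k` strands writes the identity of `[k]` as a sum of `2^k` maps, each of which
factors through some `Ω([m])` (`sum_fibre_comp`). Since the source has finite biproducts and split
idempotents, this suffices (`mem_essImage_of_retract`).

The square commutes. Let `a : u → V`, `e_i ↦ (e^i_1 - e^i_{-1})/√2`, and let `a*` be its adjoint, so
that `a* a = 1`. The power of `2` in `Ω₀` is exactly the one for which `H'(Ω₀(p)) = a^{⊗l} T_p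
(a*)^{⊗k}` (`permFunctor_map_omegaPart`). Thus `a^{⊗k}` and `(a*)^{⊗k}` give isomorphisms `H(Ω([k]))
≅ G([k])`, natural in all morphisms between generators, and such a family extends to all objects
(`exists_iso_extending`).

For strict commutativity, `Ω` is injective on objects, so it has a quasi-inverse `R` with `Ω ⋙ R`
equal to the identity on the nose. Then `R ⋙ G` is the required choice of `H`; comparing `G` with an
arbitrary extension of `H'` shows that it extends `H'`. -/

namespace Hyperoctahedral

/-! ### Finite retracts: extending natural transformations, essential images, strict inverses -/

section Retracts

open Limits

/-- A decomposition of the identity of `P` through finitely many objects in the image of `J`. -/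
structure FiniteRetract {C E : Type*} [Category C] [Category E] [Preadditive E] (J : C ⥤ E)
    (P : E) where
  ι : Type
  fintype : Fintype ι
  c : ι → C
  i : ∀ x, P ⟶ J.obj (c x)
  r : ∀ x, J.obj (c x) ⟶ P
  sum_eq : ∑ x, i x ≫ r x = 𝟙 P

attribute [instance] FiniteRetract.fintype

variable {C E D : Type*} [Category C] [Category E] [Preadditive E] [Category D] [Preadditive D]

/-- Extension of a natural transformation along a full functor `J` such that every object is a
retract of a finite sum of objects in the image of `J`. -/
noncomputable def extendNatTrans (J : C ⥤ E) [J.Full] (R : ∀ P, FiniteRetract J P)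
    {F F' : E ⥤ D} [F.Additive] [F'.Additive] (τ : J ⋙ F ⟶ J ⋙ F') : F ⟶ F' where
  app P := ∑ x, F.map ((R P).i x) ≫ τ.app ((R P).c x) ≫ F'.map ((R P).r x)
  naturality P Q f := by
    have h : ∀ x y, F.map ((R P).r x ≫ f ≫ (R Q).i y) ≫ τ.app ((R Q).c y) =
        τ.app ((R P).c x) ≫ F'.map ((R P).r x ≫ f ≫ (R Q).i y) := by
      intro x y
      -- Fullness makes `τ` natural for every map between objects in the image of `J`, not only for
      -- those named by a map of `C`.
      obtain ⟨g, hg⟩ := J.map_surjective ((R P).r x ≫ f ≫ (R Q).i y)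
      rw [← hg]
      exact τ.naturality g
    -- Inserting the decomposition of `𝟙 P` on one side and that of `𝟙 Q` on the other turns both
    -- composites into double sums that `h` matches term by term.
    have h1 : F.map f ≫ ∑ y, F.map ((R Q).i y) ≫ τ.app ((R Q).c y) ≫ F'.map ((R Q).r y) =
        ∑ x, ∑ y, F.map ((R P).i x) ≫ (F.map ((R P).r x ≫ f ≫ (R Q).i y) ≫
          τ.app ((R Q).c y)) ≫ F'.map ((R Q).r y) := by
      conv_lhs => rw [← Category.id_comp f, ← (R P).sum_eq]
      simp only [Preadditive.sum_comp, Preadditive.comp_sum, Functor.map_sum, Functor.map_comp,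
        Category.assoc]
      exact Finset.sum_comm
    have h2 : (∑ x, F.map ((R P).i x) ≫ τ.app ((R P).c x) ≫ F'.map ((R P).r x)) ≫ F'.map f =
        ∑ x, ∑ y, F.map ((R P).i x) ≫ (τ.app ((R P).c x) ≫
          F'.map ((R P).r x ≫ f ≫ (R Q).i y)) ≫ F'.map ((R Q).r y) := by
      conv_lhs => rw [← Category.comp_id f, ← (R Q).sum_eq]
      simp only [Preadditive.sum_comp, Preadditive.comp_sum, Functor.map_sum, Functor.map_comp,
        Category.assoc]
      exact Finset.sum_comm
    rw [h1, h2]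
    simp only [h]

/-- The value does not depend on the decomposition: by fullness `τ` slides past each retraction, and
what remains is `F` of the decomposed identity. In particular the formula gives back `τ` on the
image of `J`. -/
theorem extendNatTrans_app (J : C ⥤ E) [J.Full] (R : ∀ P, FiniteRetract J P)
    {F F' : E ⥤ D} [F.Additive] [F'.Additive] (τ : J ⋙ F ⟶ J ⋙ F') (c : C) :
    (extendNatTrans J R τ).app (J.obj c) = τ.app c := by
  have h : ∀ x, τ.app ((R (J.obj c)).c x) ≫ F'.map ((R (J.obj c)).r x) =
      F.map ((R (J.obj c)).r x) ≫ τ.app c := by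
    intro x
    obtain ⟨g, hg⟩ := J.map_surjective ((R (J.obj c)).r x)
    rw [← hg]
    exact (τ.naturality g).symm
  change ∑ x, F.map _ ≫ τ.app _ ≫ F'.map _ = _
  simp only [h, ← Category.assoc, ← F.map_comp]
  rw [← Preadditive.sum_comp, ← F.map_sum, (R (J.obj c)).sum_eq, F.map_id]
  exact Category.id_comp _

/-- Uniqueness to go with `extendNatTrans`: it shows that the extensions of two mutually inverse
transformations are mutually inverse. -/
theorem natTrans_ext_of_retract (J : C ⥤ E) (R : ∀ P, FiniteRetract J P)
    {F F' : E ⥤ D} [F.Additive] [F'.Additive] {σ τ : F ⟶ F'}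
    (h : ∀ c, σ.app (J.obj c) = τ.app (J.obj c)) : σ = τ := by
  ext P
  rw [← Category.id_comp (σ.app P), ← Category.id_comp (τ.app P), ← F.map_id, ← (R P).sum_eq]
  simp only [Functor.map_sum, Functor.map_comp, Preadditive.sum_comp, Category.assoc,
    NatTrans.naturality, h]

/-- Natural isomorphisms of additive functors extend along full functors `J` such that every object
is a retract of a finite sum of objects in the image of `J`. -/
theorem exists_iso_extending (J : C ⥤ E) [J.Full] (R : ∀ P, FiniteRetract J P)
    {F F' : E ⥤ D} [F.Additive] [F'.Additive] (τ : J ⋙ F ≅ J ⋙ F') :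
    ∃ η : F ≅ F', ∀ c, η.hom.app (J.obj c) = τ.hom.app c := by
  refine ⟨⟨extendNatTrans J R τ.hom, extendNatTrans J R τ.inv, ?_, ?_⟩,
    extendNatTrans_app J R τ.hom⟩
  · refine natTrans_ext_of_retract J R fun c => ?_
    rw [NatTrans.comp_app, extendNatTrans_app, extendNatTrans_app]
    exact τ.hom_inv_id_app c
  · refine natTrans_ext_of_retract J R fun c => ?_
    rw [NatTrans.comp_app, extendNatTrans_app, extendNatTrans_app]
    exact τ.inv_hom_id_app c

/-- Retracts of finite sums of objects in the image of a fully faithful additive functor lie in its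
essential image. -/
theorem mem_essImage_of_retract [Preadditive C] [HasFiniteBiproducts C] [IsIdempotentComplete C]
    (K : C ⥤ E) [K.Full] [K.Faithful] [K.Additive] {Y : E} (R : FiniteRetract K Y) :
    K.essImage Y := by
  classical
  let i : Y ⟶ K.obj (⨁ R.c) := ∑ x, R.i x ≫ K.map (biproduct.ι R.c x)
  let r : K.obj (⨁ R.c) ⟶ Y := ∑ x, K.map (biproduct.π R.c x) ≫ R.r x
  have hir : i ≫ r = 𝟙 Y := by
    rw [← R.sum_eq]
    simp only [i, r, Preadditive.sum_comp, Preadditive.comp_sum, Category.assoc]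
    refine Finset.sum_congr rfl fun x _ => ?_
    rw [Finset.sum_eq_single x]
    · rw [← K.map_comp_assoc, biproduct.ι_π_self, K.map_id, Category.id_comp]
    · intro y _ hy
      rw [← K.map_comp_assoc, biproduct.ι_π_ne _ hy, K.map_zero, zero_comp, comp_zero]
    · simp
  -- `Y` is the image of the idempotent `r ≫ i` of `K.obj (⨁ R.c)`. This comes from an idempotent of
  -- `⨁ R.c` by fullness and faithfulness; the object `Z` that splits it is the preimage of `Y`.
  obtain ⟨Z, j, s, hjs, hsj⟩ := IsIdempotentComplete.idempotents_split _ (K.preimage (r ≫ i))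
    (K.map_injective (by simp [reassoc_of% hir]))
  have hK : K.map s ≫ K.map j = r ≫ i := by rw [← K.map_comp, hsj, K.map_preimage]
  refine ⟨Z, ⟨⟨K.map j ≫ r, i ≫ K.map s, ?_, ?_⟩⟩⟩
  · have : K.map j ≫ K.map s = 𝟙 _ := by rw [← K.map_comp, hjs, K.map_id]
    calc (K.map j ≫ r) ≫ i ≫ K.map s = K.map j ≫ (r ≫ i) ≫ K.map s := by simp
      _ = (K.map j ≫ K.map s) ≫ K.map j ≫ K.map s := by rw [← hK]; simp
      _ = 𝟙 _ := by rw [this, Category.id_comp]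
  · calc (i ≫ K.map s) ≫ K.map j ≫ r = i ≫ (K.map s ≫ K.map j) ≫ r := by simp
      _ = (i ≫ r) ≫ i ≫ r := by rw [hK]; simp
      _ = 𝟙 Y := by rw [hir, Category.id_comp]

/-- Composition of decompositions of identities. -/
def FiniteRetract.trans {C' : Type*} [Category C'] {J : C ⥤ E} {J' : C' ⥤ E} {P : E}
    (R : FiniteRetract J P) (S : ∀ c, FiniteRetract J' (J.obj c)) : FiniteRetract J' P where
  ι := Σ x : R.ι, (S (R.c x)).ι
  fintype := inferInstance
  c x := (S (R.c x.1)).c x.2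
  i x := R.i x.1 ≫ (S (R.c x.1)).i x.2
  r x := (S (R.c x.1)).r x.2 ≫ R.r x.1
  sum_eq := by
    rw [Fintype.sum_sigma, ← R.sum_eq]
    refine Finset.sum_congr rfl fun x _ => ?_
    have h := (S (R.c x)).sum_eq
    calc _ = R.i x ≫ (∑ y, (S (R.c x)).i y ≫ (S (R.c x)).r y) ≫ R.r x := by
          simp only [Preadditive.sum_comp, Preadditive.comp_sum, Category.assoc]
      _ = _ := by rw [h, Category.id_comp]

/-- A decomposition of an identity through objects in the image of a composite. -/
def FiniteRetract.ofComp {C' : Type*} [Category C'] {J : C ⥤ C'} {K : C' ⥤ E} {P : E}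
    (R : FiniteRetract (J ⋙ K) P) : FiniteRetract K P where
  ι := R.ι
  fintype := R.fintype
  c x := J.obj (R.c x)
  i := R.i
  r := R.r
  sum_eq := R.sum_eq

/-- A fully faithful essentially surjective functor which is injective on objects has a strict left
inverse. -/
theorem exists_strict_inverse [Linear ℂ D] [Linear ℂ E] (K : D ⥤ E)
    [K.IsEquivalence] [K.Additive] [K.Linear ℂ] (hK : Function.Injective K.obj) :
    ∃ R : E ⥤ D, R.Additive ∧ R.Linear ℂ ∧ K ⋙ R = 𝟭 D ∧ Nonempty (R ⋙ K ≅ 𝟭 E) := by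
  -- Preimages are chosen so that `K.obj X` gets `X` itself with the identity. Injectivity on
  -- objects makes this consistent, and it is what makes `K ⋙ R` equal, not just isomorphic, to the
  -- identity.
  have hs : ∀ Y : E, ∃ s : Σ X, K.obj X ≅ Y, ∀ X (h : K.obj X = Y), s = ⟨X, eqToIso h⟩ := by
    intro Y
    by_cases hY : ∃ X, K.obj X = Y
    · obtain ⟨X, rfl⟩ := hY
      refine ⟨⟨X, Iso.refl _⟩, fun X' h => ?_⟩
      obtain rfl := hK h
      rfl
    · exact ⟨⟨K.objPreimage Y, K.objObjPreimageIso Y⟩, fun X h => (hY ⟨X, h⟩).elim⟩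
  choose s hs using hs
  let R : E ⥤ D :=
    { obj := fun Y => (s Y).1
      map := fun {Y Z} f => K.preimage ((s Y).2.hom ≫ f ≫ (s Z).2.inv)
      map_id := fun Y => K.map_injective (by simp)
      map_comp := fun f g => K.map_injective (by simp) }
  refine ⟨R, ⟨fun {Y Z f g} => K.map_injective ?_⟩, ⟨fun {Y Z} f r => K.map_injective ?_⟩, ?_,
    ⟨NatIso.ofComponents (fun Y => (s Y).2) fun {Y Z} f => ?_⟩⟩
  · rw [K.map_add]
    simp [R]
  · rw [K.map_smul]
    simp [R]
  · refine Functor.hext (fun X => congrArg Sigma.fst (hs _ X rfl)) fun X X' f => ?_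
    change K.preimage ((s (K.obj X)).2.hom ≫ K.map f ≫ (s (K.obj X')).2.inv) ≍ f
    have h := hs _ X rfl
    have h' := hs _ X' rfl
    -- With the chosen pairs as variables, both can be replaced by the identity pairs, and the
    -- heterogeneous equality becomes an ordinary one.
    generalize s (K.obj X) = a at h ⊢
    generalize s (K.obj X') = b at h' ⊢
    subst h h'
    refine heq_of_eq (K.map_injective ?_)
    simp
  · change K.map (K.preimage _) ≫ _ = _
    simp

end Retracts

/-! ### The Karoubian envelope: retracts of generators and extension of linear functors -/

section Envelopes

variable {C : Type*} [Category C] [Preadditive C]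

instance : (generators C).Full := by
  unfold generators
  infer_instance

instance : (generators C).Additive := by
  unfold generators
  infer_instance

/-- The projection of a formal direct sum to a summand. -/
noncomputable def matProj (M : Mat_ C) (x : M.ι) : M ⟶ (Mat_.embedding C).obj (M.X x) :=
  fun j _ => (𝟙 M : Mat_.Hom M M) j x

/-- The inclusion of a summand into a formal direct sum. -/
noncomputable def matIncl (M : Mat_ C) (x : M.ι) : (Mat_.embedding C).obj (M.X x) ⟶ M :=
  fun _ j => (𝟙 M : Mat_.Hom M M) x j

theorem sum_matProj_comp_matIncl (M : Mat_ C) : ∑ x, matProj M x ≫ matIncl M x = 𝟙 M := by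
  refine Mat_.hom_ext _ _ fun i j => ?_
  let ev : (M ⟶ M) →+ (M.X i ⟶ M.X j) :=
    { toFun := fun f => f i j
      map_zero' := rfl
      map_add' := fun _ _ => rfl }
  change ev (∑ x, matProj M x ≫ matIncl M x) = ev (𝟙 M)
  -- Writing `𝟙 M` as `𝟙 M ≫ 𝟙 M` makes its `(i, j)` entry a sum over the same `x` as on the left,
  -- so no case distinction on `i = j` is needed.
  rw [map_sum, ← Category.comp_id (𝟙 M)]
  refine Eq.trans ?_ (Mat_.comp_apply (𝟙 M) (𝟙 M) i j).symm
  exact Finset.sum_congr rfl fun x _ => Finset.sum_singleton _ _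

/-- Every object of the Karoubian envelope is a retract of a finite sum of generators. -/
noncomputable def envelopeRetract (P : Idempotents.Karoubi (Mat_ C)) :
    FiniteRetract (generators C) P where
  ι := P.X.ι
  fintype := inferInstance
  c := P.X.X
  i x := P.decompId_i ≫ (Idempotents.toKaroubi (Mat_ C)).map (matProj P.X x)
  r x := (Idempotents.toKaroubi (Mat_ C)).map (matIncl P.X x) ≫ P.decompId_p
  sum_eq := by
    refine Idempotents.Karoubi.hom_ext _ _ ?_
    rw [Idempotents.Karoubi.sum_hom]
    change ∑ x, (P.p ≫ matProj P.X x) ≫ matIncl P.X x ≫ P.p = P.p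
    have h : ∀ x, (P.p ≫ matProj P.X x) ≫ matIncl P.X x ≫ P.p =
        P.p ≫ (matProj P.X x ≫ matIncl P.X x) ≫ P.p := fun x => by simp only [Category.assoc]
    rw [Finset.sum_congr rfl fun x _ => h x, ← Preadditive.comp_sum, ← Preadditive.sum_comp,
      sum_matProj_comp_matIncl, Category.id_comp, P.idem]

open Limits

instance [Linear ℂ C] : (Idempotents.toKaroubi C).Linear ℂ where
  map_smul _ _ := rfl

universe v

variable {C D : Type*} [Category.{v} C] [Preadditive C] [Linear ℂ C] [Category.{v} D]
  [Preadditive D] [Linear ℂ D]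

/-- Linear functors to idempotent complete categories with finite biproducts extend to the
Karoubian envelope. -/
theorem exists_karExtension [HasFiniteBiproducts D] [IsIdempotentComplete D] (F : C ⥤ D)
    [F.Additive] [F.Linear ℂ] : Nonempty (KarExtension F) := by
  -- Extension to matrices: a formal direct sum goes to the actual biproduct in `D`.
  let L : Mat_ C ⥤ D := F.mapMat_ ⋙ Mat_.lift (𝟭 D)
  have hLa : ∀ {M N : Mat_ C} (f g : M ⟶ N), L.map (f + g) = L.map f + L.map g := by
    intro M N f g
    change biproduct.matrix (fun i j => F.map (f i j + g i j)) =
      biproduct.matrix (fun i j => F.map (f i j)) + biproduct.matrix (fun i j => F.map (g i j))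
    refine biproduct.hom_ext _ _ fun j => biproduct.hom_ext' _ _ fun i => ?_
    simp
  have hLl : ∀ {M N : Mat_ C} (r : ℂ) (f : M ⟶ N), L.map (r • f) = r • L.map f := by
    intro M N r f
    change biproduct.matrix (fun i j => F.map (r • f i j)) =
      r • biproduct.matrix (fun i j => F.map (f i j))
    refine biproduct.hom_ext _ _ fun j => biproduct.hom_ext' _ _ fun i => ?_
    simp
  -- Extension to idempotents lands in the Karoubi envelope of `D`, which is equivalent to `D`
  -- because idempotents split there; `Q` below is the way back.
  let K := (Idempotents.functorExtension₂ (Mat_ C) D).obj L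
  have hKa : K.Additive := ⟨Idempotents.Karoubi.hom_ext _ _ (hLa _ _)⟩
  have hKl : K.Linear ℂ := ⟨fun f r => Idempotents.Karoubi.hom_ext _ _ (hLl _ _)⟩
  have e1 : (Idempotents.toKaroubiEquivalence D).functor.Linear ℂ :=
    inferInstanceAs ((Idempotents.toKaroubi D).Linear ℂ)
  have e2 := (Idempotents.toKaroubiEquivalence D).inverse_additive
  have e3 := (Idempotents.toKaroubiEquivalence D).inverseLinear ℂ
  let Q := (Idempotents.toKaroubiEquivalence D).inverse
  refine ⟨⟨K ⋙ Q, inferInstance, inferInstance, ?_⟩⟩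
  have i1 : Idempotents.toKaroubi (Mat_ C) ⋙ K ≅ L ⋙ Idempotents.toKaroubi D :=
    (Idempotents.functorExtension₂CompWhiskeringLeftToKaroubiIso (Mat_ C) D).app L
  have i2 : Mat_.embedding C ⋙ L ≅ F :=
    Functor.isoWhiskerLeft F (Mat_.embeddingLiftIso (𝟭 D))
  exact Functor.isoWhiskerLeft (Mat_.embedding C) (Functor.isoWhiskerRight i1 Q) ≪≫
    Functor.isoWhiskerRight i2 (Idempotents.toKaroubi D ⋙ Q) ≪≫
    Functor.isoWhiskerLeft F (Idempotents.toKaroubiEquivalence D).unitIso.symm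

end Envelopes

/-! ### Full faithfulness of `Ω` and injectivity on objects -/

section OmegaEquivalence

variable {t : ℂ}

theorem omegaMat_add {M N : Mat_ (RepZero t)} (f g : M ⟶ N) :
    omegaMat (f + g) = omegaMat f + omegaMat g :=
  Mat_.hom_ext _ _ fun i j => map_add omegaMap (f i j) (g i j)

theorem omegaMat_smul {M N : Mat_ (RepZero t)} (r : ℂ) (f : M ⟶ N) :
    omegaMat (r • f) = r • omegaMat f :=
  Mat_.hom_ext _ _ fun i j => map_smul omegaMap r (f i j)

instance : (Omega t).Additive where
  map_add := Idempotents.Karoubi.hom_ext _ _ (omegaMat_add _ _)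

instance : (Omega t).Linear ℂ where
  map_smul _ _ := Idempotents.Karoubi.hom_ext _ _ (omegaMat_smul _ _)

/-- Each idempotent is a signed average of labelled strands, and composing with strands only
relabels the outer vertices. Starting from labels `1`, a pair of strands produces each labelling
exactly once. -/
theorem sandwich_expand (t : ℂ) {k l : ℕ} (p : Setoid (Fin k ⊕ Fin l)) :
    signIdemPow t k ≫ Par.ofCol t (Col.mk p 1) ≫ signIdemPow t l =
      (1 / 2 : ℂ) ^ (k + l) • ∑ u : Fin k ⊕ Fin l → ℤˣ,
        sgn (∏ v, u v) • Par.ofCol t (Col.mk p u) := by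
  rw [signIdemPow_eq, signIdemPow_eq,
    ← (Equiv.sumArrowEquivProdArrow (Fin k) (Fin l) ℤˣ).symm.sum_comp, Fintype.sum_prod_type]
  simp only [Linear.smul_comp, Linear.comp_smul, Preadditive.sum_comp, Preadditive.comp_sum,
    comp_strand, strand_comp, smul_smul, Finset.smul_sum, pow_add]
  rw [Finset.sum_comm]
  refine Finset.sum_congr rfl fun z _ => Finset.sum_congr rfl fun w _ => ?_
  have h : Sum.elim (z * (Sum.elim ((1 : Fin k ⊕ Fin l → ℤˣ) ∘ Sum.inl)
      (w * (1 : Fin k ⊕ Fin l → ℤˣ) ∘ Sum.inr)) ∘ Sum.inl)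
      ((Sum.elim ((1 : Fin k ⊕ Fin l → ℤˣ) ∘ Sum.inl)
      (w * (1 : Fin k ⊕ Fin l → ℤˣ) ∘ Sum.inr)) ∘ Sum.inr) =
      (Equiv.sumArrowEquivProdArrow (Fin k) (Fin l) ℤˣ).symm (z, w) := by
    ext (a | a) <;> simp
  rw [h, Fintype.prod_sum_type, map_mul]
  simp only [Equiv.sumArrowEquivProdArrow_symm_apply_inl,
    Equiv.sumArrowEquivProdArrow_symm_apply_inr]
  congr 1
  ring

/-- The product of the labels of a coloured partition, for chosen labels. -/
noncomputable def Col.sign {k l : ℕ} (P : Col (Fin k) (Fin l)) : ℂ :=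
  sgn (∏ v, (Quotient.out P).2 v)

/-- Two representatives differ by a block-constant labelling, whose product is `1` when all blocks
are even; so on even partitions the sign is independent of the chosen labels. -/
theorem Col.sign_mk {k l : ℕ} {p : Setoid (Fin k ⊕ Fin l)} (hp : IsEven p)
    (w : Fin k ⊕ Fin l → ℤˣ) : (Col.mk p w).sign = sgn (∏ v, w v) := by
  have h : colSetoid _ _ (Quotient.out (Col.mk p w)) (p, w) := Quotient.mk_out (p, w)
  obtain ⟨h1, g, hg, hw⟩ := h
  change _ = p at h1
  rw [h1] at hg
  simp only at hw
  simp only [hw, Finset.prod_mul_distrib, (isEven_iff p).1 hp g hg, one_mul]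
  rfl

open scoped Classical in
/-- The signed projection from coloured partitions to even partitions. -/
noncomputable def evenProj (t : ℂ) (k l : ℕ) : ((⟨k⟩ : Par t) ⟶ ⟨l⟩) →ₗ[ℂ] (EvenPart k l →₀ ℂ) :=
  Finsupp.linearCombination ℂ fun P : Col (Fin k) (Fin l) =>
    if h : IsEven P.part then Finsupp.single (⟨P.part, h⟩ : EvenPart k l) P.sign else 0

theorem evenProj_ofCol (t : ℂ) {k l : ℕ} (p : EvenPart k l) (w : Fin k ⊕ Fin l → ℤˣ) :
    evenProj t k l (Par.ofCol t (Col.mk p.1 w)) = Finsupp.single p (sgn (∏ v, w v)) := by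
  refine (Finsupp.linearCombination_single _ _ _).trans ?_
  rw [one_smul, dif_pos (show IsEven (Col.mk p.1 w).part from p.2), Col.sign_mk p.2]
  rfl

/-- Every labelling enters with the square of its sign, that is with `1`, and the `2 ^ (k + l)`
labellings cancel the normalisation. -/
theorem evenProj_sandwich (t : ℂ) {k l : ℕ} (p : EvenPart k l) :
    evenProj t k l (signIdemPow t k ≫ Par.ofCol t (Col.mk p.1 1) ≫ signIdemPow t l) =
      Finsupp.single p 1 := by
  rw [sandwich_expand]
  simp only [map_smul, map_sum, evenProj_ofCol, Finsupp.smul_single, smul_eq_mul, sgn_mul_self]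
  simp only [Finset.sum_const, Finset.card_univ, Fintype.card_fun, Fintype.card_fin,
    Fintype.card_sum, show Fintype.card ℤˣ = 2 from rfl, Finsupp.smul_single, nsmul_eq_mul]
  congr 1
  push_cast
  rw [mul_one, smul_eq_mul, ← mul_pow]
  norm_num

/-- Followed by `evenProj`, the map becomes diagonal in the basis of even partitions, with powers of
`2` on the diagonal. -/
theorem omegaMap_injective (X Y : RepZero t) :
    Function.Injective (omegaMap : (X ⟶ Y) →ₗ[ℂ] _) := by
  obtain ⟨k⟩ := X
  obtain ⟨l⟩ := Y
  rw [← LinearMap.ker_eq_bot, LinearMap.ker_eq_bot']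
  intro f hf
  let c : EvenPart k l → ℂ := fun p => (2 : ℂ) ^ (((k + l : ℤ) - 2 * Nat.card (Quotient p.1)) / 2)
  -- `ev` reads a morphism as the finitely supported function of its coefficients.
  let ev : ((⟨k⟩ : RepZero t) ⟶ ⟨l⟩) → EvenPart k l → ℂ := fun f p =>
    DFunLike.coe (F := EvenPart k l →₀ ℂ) f p
  have h : ∀ f p, evenProj (2 * t) k l (omegaMap f) p = c p * ev f p := by
    intro f p
    induction f using RepZero.hom_induction with
    | zero => simp only [map_zero]; exact (mul_zero _).symm
    | plus f g hf hg => rw [map_add, map_add, Finsupp.add_apply, hf, hg]; exact (mul_add _ _ _).symm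
    | smul r q =>
      rw [map_smul, map_smul, omegaMap_ofPart, omegaPart, map_smul, evenProj_sandwich,
        Finsupp.smul_apply, Finsupp.smul_apply]
      change r * (c q * Finsupp.single q (1 : ℂ) p) = c p * (r * Finsupp.single q (1 : ℂ) p)
      by_cases hpq : q = p
      · rw [hpq]
        ring
      · rw [Finsupp.single_eq_of_ne (Ne.symm hpq)]
        ring
  refine Finsupp.ext fun p => ?_
  have h1 := h f p
  rw [hf, map_zero] at h1
  exact (mul_eq_zero.1 h1.symm).resolve_left (zpow_ne_zero _ two_ne_zero)

/-- The reason for fullness: after labels are absorbed as signs, only sandwiches of unlabelled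
partitions remain. The even ones are nonzero multiples of `omegaPart`, and the others vanish. -/
theorem sandwich_mem_range {k l : ℕ} (g : (⟨k⟩ : Par (2 * t)) ⟶ ⟨l⟩) :
    signIdemPow (2 * t) k ≫ g ≫ signIdemPow (2 * t) l ∈
      LinearMap.range (omegaMap : ((⟨k⟩ : RepZero t) ⟶ ⟨l⟩) →ₗ[ℂ] _) := by
  refine Finsupp.induction_linear (motive := fun g : Col (Fin k) (Fin l) →₀ ℂ =>
    signIdemPow (2 * t) k ≫ (g : (⟨k⟩ : Par (2 * t)) ⟶ ⟨l⟩) ≫ signIdemPow (2 * t) l ∈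
      LinearMap.range (omegaMap : ((⟨k⟩ : RepZero t) ⟶ ⟨l⟩) →ₗ[ℂ] _)) g ?_ ?_ ?_
  · have h : signIdemPow (2 * t) k ≫ (0 : (⟨k⟩ : Par (2 * t)) ⟶ ⟨l⟩) ≫
        signIdemPow (2 * t) l = 0 := by
      rw [Limits.zero_comp, Limits.comp_zero]
    exact (congrArg (· ∈ _) h).mpr (Submodule.zero_mem _)
  · intro f g hf hg
    have h := Submodule.add_mem _ hf hg
    rw [← Preadditive.comp_add, ← Preadditive.add_comp] at h
    exact h
  · intro P r
    have h1 : Finsupp.single P r = r • Par.ofCol (2 * t) P :=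
      ((Finsupp.smul_single _ _ _).trans (by rw [smul_eq_mul, mul_one])).symm
    change signIdemPow (2 * t) k ≫ (Finsupp.single P r : (⟨k⟩ : Par (2 * t)) ⟶ ⟨l⟩) ≫ _ ∈ _
    rw [h1, Linear.smul_comp, Linear.comp_smul]
    refine Submodule.smul_mem _ _ ?_
    induction P using Col.ind with | _ p w => ?_
    rw [sandwich_eq]
    refine Submodule.smul_mem _ _ ?_
    by_cases hp : IsEven p
    · have h2 : omegaPart t ⟨p, hp⟩ ∈
          LinearMap.range (omegaMap : ((⟨k⟩ : RepZero t) ⟶ ⟨l⟩) →ₗ[ℂ] _) :=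
        ⟨_, omegaMap_ofPart t ⟨p, hp⟩⟩
      exact (Submodule.smul_mem_iff _ (zpow_ne_zero _ two_ne_zero)).1 h2
    · rw [isEven_iff] at hp
      push Not at hp
      obtain ⟨f, hf, hf1⟩ := hp
      -- `f` is constant on blocks with product `-1`. Relabelling by `f` fixes the coloured
      -- partition but negates its sandwich, which must then be zero.
      have h2 : Col.mk p 1 = Col.mk p f :=
        Col.mk_eq.2 ⟨f, hf, fun v => (mul_one _).symm⟩
      have h3 := sandwich_eq (2 * t) p f
      rw [← h2, (Int.units_eq_one_or _).resolve_left hf1, sgn_neg, map_one, neg_one_smul,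
        eq_neg_iff_add_eq_zero, ← two_smul ℂ, smul_eq_zero_iff_right two_ne_zero] at h3
      rw [h3]
      exact Submodule.zero_mem _

/-- The outer factors absorb `e'`, since `e'^{⊗k}` is the image of an identity; so `g` may be
replaced by its sandwich, which already comes from a morphism of even partitions. -/
theorem omegaMap_comp_comp_mem_range {X Y X' Y' : RepZero t} (a : X ⟶ X') (b : Y' ⟶ Y)
    (g : (⟨X'.n⟩ : Par (2 * t)) ⟶ ⟨Y'.n⟩) :
    omegaMap a ≫ g ≫ omegaMap b ∈ LinearMap.range (omegaMap : (X ⟶ Y) →ₗ[ℂ] _) := by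
  obtain ⟨f, hf⟩ := sandwich_mem_range g
  refine ⟨a ≫ f ≫ b, ?_⟩
  rw [omegaMap_comp, omegaMap_comp, hf, ← omegaMap_id, ← omegaMap_id]
  simp only [← Category.assoc]
  rw [← omegaMap_comp, Category.comp_id]
  simp only [Category.assoc]
  rw [← omegaMap_comp, Category.id_comp]

theorem omegaMat_injective (M N : Mat_ (RepZero t)) :
    Function.Injective (omegaMat : (M ⟶ N) → _) := fun _ _ h =>
  Mat_.hom_ext _ _ fun i j => omegaMap_injective _ _ (congrFun (congrFun h i) j)

instance : (Omega t).Faithful where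
  map_injective h := Idempotents.Karoubi.hom_ext _ _
    (omegaMat_injective _ _ (congrArg Idempotents.Karoubi.Hom.f h))

instance : (Omega t).Full where
  map_surjective {P Q} g := by
    have h : ∀ i j, g.f i j ∈
        LinearMap.range (omegaMap : (P.X.X i ⟶ Q.X.X j) →ₗ[ℂ] _) := by
      intro i j
      -- A morphism of the Karoubi envelope equals its composite with the two idempotents, here
      -- images under `omegaMat`; this is the `(i, j)` entry of that identity.
      have h1 : g.f i j = ∑ x, omegaMap (P.p i x) ≫ ∑ y, g.f x y ≫ omegaMap (Q.p y j) :=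
        congrFun (congrFun g.comm i) j |>.symm
      rw [h1]
      simp only [Preadditive.comp_sum]
      exact Submodule.sum_mem _ fun x _ => Submodule.sum_mem _ fun y _ =>
        omegaMap_comp_comp_mem_range _ _ _
    choose f hf using h
    -- The entrywise lift is a morphism between the given idempotents because the required identity
    -- holds after `omegaMat`, which is injective.
    have hfg : omegaMat f = g.f := Mat_.hom_ext _ _ hf
    refine ⟨⟨f, omegaMat_injective _ _ ?_⟩, Idempotents.Karoubi.hom_ext _ _ hfg⟩
    refine (omegaMat_comp _ _).trans (Eq.trans ?_ (g.comm.trans hfg.symm))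
    exact congrArg (omegaMat P.p ≫ ·) ((omegaMat_comp _ _).trans (congrArg (· ≫ omegaMat Q.p) hfg))

/-- `Ω` keeps the index type and the sizes of a formal direct sum, and `omegaMat` is injective on
idempotents. Needed only for the strict form of the square. -/
theorem omega_obj_injective : Function.Injective (Omega t).obj := by
  rintro ⟨M, p, hp⟩ ⟨M', p', hp'⟩ h
  obtain rfl : M = M' := congrArg
    (fun N : Idempotents.Karoubi (Mat_ (Par (2 * t))) =>
      (⟨N.X.ι, fun i => ⟨(N.X.X i).n⟩⟩ : Mat_ (RepZero t))) h
  have h2 : omegaMat p = omegaMat p' := by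
    have h3 := Idempotents.Karoubi.mk.inj h
    exact eq_of_heq h3.2
  obtain rfl := omegaMat_injective _ _ h2
  rfl

end OmegaEquivalence

/-! ### Essential surjectivity of `Ω`: doubling strands -/

section Strands

variable {k m : ℕ} {t : ℂ}

/-- The partition whose blocks are the lower vertices `x`, together with the upper vertices in the
fibre of `g` over `x`. -/
def fibrePart (g : Fin m → Fin k) : Setoid (Fin k ⊕ Fin m) := Setoid.ker (Sum.elim id g)

/-- The reflection of `fibrePart`. -/
def fibrePart' (g : Fin m → Fin k) : Setoid (Fin m ⊕ Fin k) := Setoid.ker (Sum.elim g id)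

/-- Both rows of `g`-fibres are attached to the same points, so the blocks are indexed by `Fin k`.
Surjectivity is what links each top vertex to the bottom one, through a point of its fibre. -/
theorem stack_fibrePart {g : Fin m → Fin k} (hg : Function.Surjective g) :
    stack (fibrePart g) (fibrePart' g) = Setoid.ker (Sum.elim id (Sum.elim g id)) := by
  apply le_antisymm
  · refine sInf_le ⟨?_, fun a b h => h⟩
    rintro (a | a) (b | b) h <;> exact h
  · refine le_sInf ?_
    rintro r ⟨h1, h2⟩
    have h3 : ∀ v, r v (Sum.inl (Sum.elim id (Sum.elim g id) v)) := by
      have h4 : ∀ y, r (Sum.inr (Sum.inl y)) (Sum.inl (g y)) := fun y =>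
        h1 (Sum.inr y) (Sum.inl (g y)) rfl
      rintro (x | y | z)
      · exact r.refl _
      · exact h4 y
      · obtain ⟨y, rfl⟩ := hg z
        exact r.trans (h2 (Sum.inr (g y)) (Sum.inl y) rfl) (h4 y)
    intro v w (h : Sum.elim id (Sum.elim g id) v = Sum.elim id (Sum.elim g id) w)
    have h5 := h3 v
    rw [h] at h5
    exact r.trans h5 (r.symm (h3 w))

theorem vcomp_fibrePart {g : Fin m → Fin k} (hg : Function.Surjective g) :
    vcomp (fibrePart g) (fibrePart' g) = idPart (Fin k) := by
  rw [vcomp, stack_fibrePart hg]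
  ext (a | a) (b | b) <;> exact Iff.rfl

theorem loops_fibrePart {g : Fin m → Fin k} (hg : Function.Surjective g) :
    loops (fibrePart g) (fibrePart' g) = 0 := by
  rw [loops, Nat.card_eq_zero]
  left
  refine ⟨fun ⟨c, hc⟩ => ?_⟩
  induction c using Quotient.ind with | _ v => ?_
  refine hc (Sum.inl (Sum.elim id (Sum.elim g id) v)) (Quotient.sound ?_)
  change stack (fibrePart g) (fibrePart' g) _ _
  rw [stack_fibrePart hg]
  rfl

/-- Middle labels of the form `w ∘ g` are constant on fibres, so rescaling the blocks of the upper
partition moves them to the top row as `w`; no loops arise. -/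
theorem fibre_comp_strand (t : ℂ) {g : Fin m → Fin k} (hg : Function.Surjective g)
    (w : Fin k → ℤˣ) :
    Par.ofCol t (Col.mk (fibrePart g) 1) ≫ Par.ofCol t (strand (w ∘ g)) ≫
      Par.ofCol t (Col.mk (fibrePart' g) 1) = Par.ofCol t (strand w) := by
  have h1 : Col.mk (fibrePart' g) (Sum.elim ((w ∘ g) * (1 : Fin m ⊕ Fin k → ℤˣ) ∘ Sum.inl)
      ((1 : Fin m ⊕ Fin k → ℤˣ) ∘ Sum.inr)) =
      Col.mk (fibrePart' g) (Sum.elim (1 : Fin k → ℤˣ) (Sum.elim 1 w) ∘ Sum.inr) := by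
    refine Col.mk_eq.2 ⟨fun v => w (Sum.elim g id v), fun a b h => congrArg w h, ?_⟩
    rintro (y | z)
    · change 1 = w (g y) * (w (g y) * 1)
      rw [mul_one, Int.units_mul_self]
    · exact (mul_one _).symm
  have h2 : (1 : Fin k ⊕ Fin m → ℤˣ) =
      Sum.elim (1 : Fin k → ℤˣ) (Sum.elim (1 : Fin m → ℤˣ) w) ∘ lowerRows := by
    funext v
    rcases v with a | a <;> rfl
  have h3 : strand w = Col.mk (idPart (Fin k))
      (Sum.elim (1 : Fin k → ℤˣ) (Sum.elim (1 : Fin m → ℤˣ) w) ∘ outerRows) := by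
    -- A strand has its label on the lower vertex by convention; multiplying each block by `w` moves
    -- it to the upper vertex.
    refine Col.mk_eq.2 ⟨Sum.elim w w, ?_, ?_⟩
    · rintro (a | a) (b | b) (h : a = b) <;> subst h <;> rfl
    · rintro (a | a)
      · exact (Int.units_mul_self _).symm
      · exact (mul_one _).symm
  rw [strand_comp, h1, h2, ofCol_comp, colMul_mk, vcomp_fibrePart hg, ← h3, Option.elim]
  change t ^ loops (fibrePart g) (fibrePart' g) • _ = _
  rw [loops_fibrePart hg, pow_zero, one_smul]

/-- If the composition is defined, then `z` is constant on the fibres of `g`, hence of the form `w ∘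
g` with `w` obtained from any section of `g`. -/
theorem fibre_comp_strand_eq_zero (t : ℂ) {g : Fin m → Fin k} (hg : Function.Surjective g)
    {z : Fin m → ℤˣ} (hz : ∀ w : Fin k → ℤˣ, w ∘ g ≠ z) :
    Par.ofCol t (Col.mk (fibrePart g) 1) ≫ Par.ofCol t (strand z) ≫
      Par.ofCol t (Col.mk (fibrePart' g) 1) = 0 := by
  rw [strand_comp, ofCol_comp]
  rcases colMul_cases (Col.mk (fibrePart g) 1) (Col.mk (fibrePart' g)
    (Sum.elim (z * (1 : Fin m ⊕ Fin k → ℤˣ) ∘ Sum.inl)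
      ((1 : Fin m ⊕ Fin k → ℤˣ) ∘ Sum.inr))) with ⟨p, q, c, h1, h2⟩ | ⟨h, -⟩
  · exfalso
    obtain rfl := Col.mk_eq' h1
    obtain rfl := Col.mk_eq' h2
    obtain ⟨a, ha, ha'⟩ := Col.mk_eq.1 h1
    obtain ⟨b, hb, hb'⟩ := Col.mk_eq.1 h2
    refine hz (z ∘ Function.surjInv hg) (funext fun y => ?_)
    have hy : g (Function.surjInv hg (g y)) = g y := Function.surjInv_eq hg _
    have e1 : ∀ y, c (Sum.inr (Sum.inl y)) = a (Sum.inr y) * 1 := fun y => ha' (Sum.inr y)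
    have e2 : ∀ y, c (Sum.inr (Sum.inl y)) = b (Sum.inl y) * (z y * 1) := fun y => hb' (Sum.inl y)
    have e3 : a (Sum.inr (Function.surjInv hg (g y))) = a (Sum.inr y) := ha _ _ hy
    have e4 : b (Sum.inl (Function.surjInv hg (g y))) = b (Sum.inl y) := hb _ _ hy
    have e5 := (e2 (Function.surjInv hg (g y))).symm.trans (e1 _)
    rw [e3, e4, ← e1 y, e2 y, mul_one, mul_one] at e5
    exact mul_left_cancel e5
  · rw [h]
    rfl

/-- In the expansion of `e'^{⊗m}` only the labels `w ∘ g` survive, and `w` is determined by `w ∘ g`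
as `g` is surjective. The sign of `w x` is raised to the size of the fibre over `x`. -/
theorem fibre_comp_signIdemPow (t : ℂ) {g : Fin m → Fin k} (hg : Function.Surjective g) :
    Par.ofCol t (Col.mk (fibrePart g) 1) ≫ signIdemPow t m ≫
      Par.ofCol t (Col.mk (fibrePart' g) 1) =
      (1 / 2 : ℂ) ^ m • ∑ w : Fin k → ℤˣ, sgn (∏ y, w (g y)) • Par.ofCol t (strand w) := by
  rw [signIdemPow_eq, Linear.smul_comp, Linear.comp_smul, Preadditive.sum_comp,
    Preadditive.comp_sum]
  congr 1
  symm
  refine Finset.sum_of_injOn (fun w => w ∘ g) (fun w _ w' _ h => hg.injective_comp_right h)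
    (fun _ _ => Finset.mem_coe.2 (Finset.mem_univ _)) (fun z _ hz => ?_) fun w _ => ?_
  · rw [Linear.smul_comp, Linear.comp_smul, fibre_comp_strand_eq_zero t hg fun w hw => hz
      ⟨w, Finset.mem_coe.2 (Finset.mem_univ _), hw⟩, smul_zero]
  · rw [Linear.smul_comp, Linear.comp_smul, fibre_comp_strand t hg]
    rfl

/-- A number of upper vertices for each lower vertex: one or two. -/
abbrev Fibres (s : Fin k → Fin 2) : Type := Σ x, Fin (1 + s x)

/-- The map which sends the upper vertices to the lower ones. -/
noncomputable def fibreMap (s : Fin k → Fin 2) : Fin (Fintype.card (Fibres s)) → Fin k :=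
  fun y => ((Fintype.equivFin (Fibres s)).symm y).1

theorem fibreMap_surjective (s : Fin k → Fin 2) : Function.Surjective (fibreMap s) := fun x =>
  ⟨Fintype.equivFin (Fibres s) ⟨x, ⟨0, by omega⟩⟩, by simp [fibreMap]⟩

/-- The sum over fibre sizes one and two factors as the product over `x` of `sgn (w x) + 1`, which
is `2` for the label `1` and `0` for `-1`. -/
theorem sum_sgn_fibreMap (w : Fin k → ℤˣ) :
    ∑ s : Fin k → Fin 2, sgn (∏ y, w (fibreMap s y)) = if w = 1 then 2 ^ k else 0 := by
  have h : ∀ s : Fin k → Fin 2, sgn (∏ y, w (fibreMap s y)) =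
      ∏ x, sgn (w x) ^ (1 + (s x : ℕ)) := by
    intro s
    rw [show (∏ y, w (fibreMap s y)) = ∏ a : Fibres s, w a.1 from
      (Fintype.equivFin (Fibres s)).symm.prod_comp fun a => w a.1, Fintype.prod_sigma, map_prod]
    simp
  simp only [h]
  rw [← Fintype.prod_sum (fun x (b : Fin 2) => sgn (w x) ^ (1 + (b : ℕ)))]
  simp only [Fin.sum_univ_two, Fin.val_zero, Fin.val_one, add_zero, pow_succ, pow_zero,
    one_mul, sgn_mul_self]
  split_ifs with hw
  · subst hw
    norm_num [sgn]
  · obtain ⟨x, hx⟩ := Function.ne_iff.1 hw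
    refine Finset.prod_eq_zero (Finset.mem_univ x) ?_
    rw [(Int.units_eq_one_or _).resolve_left hx, sgn_neg, map_one, neg_add_cancel]

/-- The tensor power of `𝟙 = e' + (1 + s)/2`: fibres of size one give `e'`, fibres of size two give
the complement. The factor `2 ^ m`, with `m` the number of middle vertices, cancels the
normalisation of `e'^{⊗m}`, and `(1/2) ^ k` the value of the character sum at `w = 1`. -/
theorem sum_fibre_comp (t : ℂ) (k : ℕ) : ∑ s : Fin k → Fin 2,
    ((1 / 2 : ℂ) ^ k * 2 ^ Fintype.card (Fibres s)) •
      (Par.ofCol t (Col.mk (fibrePart (fibreMap s)) 1) ≫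
      signIdemPow t _ ≫ Par.ofCol t (Col.mk (fibrePart' (fibreMap s)) 1)) = 𝟙 (⟨k⟩ : Par t) := by
  have h1 : ∀ m : ℕ, (2 : ℂ) ^ m * (1 / 2 : ℂ) ^ m = 1 := fun m => by rw [← mul_pow]; norm_num
  simp only [fibre_comp_signIdemPow t (fibreMap_surjective _), smul_smul, mul_assoc, h1, mul_one]
  rw [← Finset.smul_sum, Finset.sum_comm]
  simp only [← Finset.sum_smul, sum_sgn_fibreMap, ite_smul, zero_smul]
  rw [Finset.sum_ite_eq' Finset.univ, if_pos (Finset.mem_univ _), smul_smul, mul_comm, h1, one_smul]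
  exact congrArg (fun P => Finsupp.single P (1 : ℂ)) (congrArg (Col.mk _) (by ext (a | a) <;> rfl))

theorem omega_generators_p (t : ℂ) (m : ℕ) :
    ((Omega t).obj ((generators (RepZero t)).obj ⟨m⟩)).p =
      (Mat_.embedding (Par (2 * t))).map (signIdemPow (2 * t) m) := by
  refine Mat_.hom_ext _ _ fun i j => ?_
  refine Eq.trans ?_ (omegaMap_id t m)
  change omegaMap ((𝟙 ((Mat_.embedding (RepZero t)).obj ⟨m⟩) : Mat_.Hom _ _) i j) = _
  exact congrArg omegaMap (Mat_.id_apply_self _ _)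

/-- The projection of `[k]` to `Ω([k]) = ([k], e'^{⊗k})`. -/
noncomputable def omegaProj (t : ℂ) (k : ℕ) :
    (generators (Par (2 * t))).obj ⟨k⟩ ⟶ (Omega t).obj ((generators (RepZero t)).obj ⟨k⟩) :=
  Idempotents.Karoubi.decompId_p
    ((Omega t).obj ((generators (RepZero t)).obj ⟨k⟩))

theorem omegaIncl_comp_omegaProj (t : ℂ) (k : ℕ) : omegaIncl t k ≫ omegaProj t k = 𝟙 _ :=
  (Idempotents.Karoubi.decompId
    ((Omega t).obj ((generators (RepZero t)).obj ⟨k⟩))).symm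

theorem omegaProj_comp_omegaIncl (t : ℂ) (k : ℕ) :
    omegaProj t k ≫ omegaIncl t k = (generators (Par (2 * t))).map (signIdemPow (2 * t) k) := by
  refine (Idempotents.Karoubi.decomp_p
    ((Omega t).obj ((generators (RepZero t)).obj ⟨k⟩))).symm.trans ?_
  exact congrArg (Idempotents.toKaroubi (Mat_ (Par (2 * t)))).map
    (omega_generators_p t k)

/-- The generators of the target are retracts of sums of images of generators. -/
noncomputable def generatorRetract (t : ℂ) (k : ℕ) :
    FiniteRetract (generators (RepZero t) ⋙ Omega t) ((generators (Par (2 * t))).obj ⟨k⟩) where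
  ι := Fin k → Fin 2
  fintype := inferInstance
  c s := ⟨Fintype.card (Fibres s)⟩
  i s := (generators (Par (2 * t))).map (Y := ⟨Fintype.card (Fibres s)⟩)
    (((1 / 2 : ℂ) ^ k * 2 ^ Fintype.card (Fibres s)) •
      Par.ofCol _ (Col.mk (fibrePart (fibreMap s)) 1)) ≫ omegaProj t _
  r s := omegaIncl t _ ≫ (generators (Par (2 * t))).map
    (X := ⟨Fintype.card (Fibres s)⟩) (Par.ofCol _ (Col.mk (fibrePart' (fibreMap s)) 1))
  sum_eq := by
    rw [← (generators (Par (2 * t))).map_id, ← sum_fibre_comp, Functor.map_sum]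
    refine Finset.sum_congr rfl fun s _ => ?_
    rw [Category.assoc, ← Category.assoc (omegaProj t _), omegaProj_comp_omegaIncl,
      ← Functor.map_comp, ← Functor.map_comp, Linear.smul_comp]

/-- Every object is a retract of a sum of generators, and these are retracts of sums of objects
`Ω([m])`; `Ω` is fully faithful and its source has biproducts and split idempotents. -/
instance : (Omega t).EssSurj where
  mem_essImage Y := mem_essImage_of_retract _
    ((envelopeRetract Y).trans fun c => generatorRetract t c.n).ofComp

instance : (Omega t).IsEquivalence where

end Strands

/-! ### Properties of the representation functors -/

section Comparison

open Limits

instance (n : ℕ) : (reflFunctor n).Additive where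
  map_add {X Y f g} :=
    map_add (Finsupp.linearCombination ℂ fun p : EvenPart X.n Y.n => reflMap n p) f g

instance (n : ℕ) : (reflFunctor n).Linear ℂ where
  map_smul {X Y} f r :=
    map_smul (Finsupp.linearCombination ℂ fun p : EvenPart X.n Y.n => reflMap n p) r f

instance (n : ℕ) : (permFunctor n).Additive where
  map_add {X Y f g} :=
    map_add (Finsupp.linearCombination ℂ fun P : Col (Fin X.n) (Fin Y.n) => permMap n P) f g

instance (n : ℕ) : (permFunctor n).Linear ℂ where
  map_smul {X Y} f r :=
    map_smul (Finsupp.linearCombination ℂ fun P : Col (Fin X.n) (Fin Y.n) => permMap n P) r f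

instance (G : Type) [Group G] : HasFiniteBiproducts (FDRep ℂ G) :=
  HasFiniteBiproducts.of_hasFiniteProducts

instance (G : Type) [Group G] : IsIdempotentComplete (FDRep ℂ G) :=
  Idempotents.isIdempotentComplete_iff_hasEqualizer_of_id_and_idempotent _ |>.2
    fun _ _ _ => inferInstance

theorem permFunctor_map_ofCol (n : ℕ) {k l : ℕ} (P : Col (Fin k) (Fin l)) :
    (permFunctor n).map (Par.ofCol _ P) = permMap n P :=
  (Finsupp.linearCombination_single (M := tensorObj (permRep n) k ⟶ tensorObj (permRep n) l)
    _ _ _).trans (one_smul _ _)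

theorem reflFunctor_map_ofPart (n : ℕ) {k l : ℕ} (p : EvenPart k l) :
    (reflFunctor n).map (RepZero.ofPart _ p) = reflMap n p :=
  (Finsupp.linearCombination_single (M := tensorObj (reflRep n) k ⟶ tensorObj (reflRep n) l)
    _ _ _).trans (one_smul _ _)

/-! ### The embedding of `u` into `V` and the image of `Ω₀` under `H'` -/

/-- The square root of `1 / 2`. -/
noncomputable def rootHalf : ℂ := ((Real.sqrt 2)⁻¹ : ℝ)

theorem rootHalf_mul_self : rootHalf * rootHalf = 1 / 2 := by
  rw [rootHalf, ← Complex.ofReal_mul, ← mul_inv, Real.mul_self_sqrt (by norm_num)]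
  norm_num

/-- The isometric embedding `u → V`, `e_i ↦ (e^i_1 - e^i_{-1}) / √2`. -/
noncomputable def reflIncl (n : ℕ) : (Fin n → ℂ) →ₗ[ℂ] (Fin n × ℤˣ → ℂ) where
  toFun c v := rootHalf * (sgn v.2 * c v.1)
  map_add' c d := by ext v; simp [mul_add]
  map_smul' r c := by ext v; simp [mul_left_comm]

/-- The adjoint of `reflIncl`. -/
noncomputable def reflProj (n : ℕ) : (Fin n × ℤˣ → ℂ) →ₗ[ℂ] (Fin n → ℂ) where
  toFun d i := rootHalf * ∑ b, sgn b * d (i, b)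
  map_add' c d := by ext v; simp [mul_add, Finset.sum_add_distrib]
  map_smul' r c := by
    ext v
    simp only [Pi.smul_apply, smul_eq_mul, mul_left_comm (sgn _) r, ← Finset.mul_sum,
      mul_left_comm rootHalf r, RingHom.id_apply]

theorem reflProj_comp_reflIncl (n : ℕ) : reflProj n ∘ₗ reflIncl n = LinearMap.id := by
  refine LinearMap.ext fun c => funext fun i => ?_
  change rootHalf * ∑ b, sgn b * (rootHalf * (sgn b * c i)) = c i
  have h : ∀ b, sgn b * (rootHalf * (sgn b * c i)) = rootHalf * c i := fun b => by
    rw [mul_left_comm, ← mul_assoc (sgn b), sgn_mul_self, one_mul]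
  simp only [h, Finset.sum_const, Finset.card_univ, show Fintype.card ℤˣ = 2 from rfl]
  rw [nsmul_eq_mul, mul_left_comm, ← mul_assoc rootHalf, rootHalf_mul_self]
  push_cast
  ring

theorem reflIncl_comm (n : ℕ) (g : Hyp n) :
    reflIncl n ∘ₗ reflRep n g = permRep n g ∘ₗ reflIncl n := by
  refine LinearMap.ext fun c => funext fun v => ?_
  change rootHalf * (sgn v.2 * (sgn (g.left v.1) * c (g.right.symm v.1))) =
    rootHalf * (sgn (g.left v.1 * v.2) * c (g.right.symm v.1))
  rw [map_mul]
  ring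

theorem reflProj_comm (n : ℕ) (g : Hyp n) :
    reflProj n ∘ₗ permRep n g = reflRep n g ∘ₗ reflProj n := by
  refine LinearMap.ext fun c => funext fun i => ?_
  change rootHalf * ∑ b, sgn b * c (g.right.symm i, g.left i * b) =
    sgn (g.left i) * (rootHalf * ∑ b, sgn b * c (g.right.symm i, b))
  rw [mul_left_comm]
  congr 1
  -- The group element permutes the two signs over each index; translating the summation variable by
  -- it extracts its sign.
  rw [Finset.mul_sum, ← Equiv.sum_comp (Equiv.mulLeft (g.left i))]
  refine Finset.sum_congr rfl fun b _ => ?_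
  rw [Equiv.coe_mulLeft, map_mul, ← mul_assoc (g.left i), Int.units_mul_self, one_mul, mul_assoc]

open scoped TensorProduct

/-- The tensor power of an equivariant map. -/
noncomputable def powHom {G I J : Type} [Group G] [Fintype I] [Fintype J]
    (ρ : Representation ℂ G (I → ℂ)) (σ : Representation ℂ G (J → ℂ))
    (f : (I → ℂ) →ₗ[ℂ] (J → ℂ)) (h : ∀ g, f ∘ₗ ρ g = σ g ∘ₗ f) (k : ℕ) :
    tensorObj ρ k ⟶ tensorObj σ k where
  hom := InducedCategory.homMk (ModuleCat.ofHom (PiTensorProduct.map fun _ : Fin k => f))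
  comm g := by
    apply InducedCategory.hom_ext
    apply ModuleCat.hom_ext
    change (PiTensorProduct.map fun _ : Fin k => f) ∘ₗ (PiTensorProduct.map fun _ : Fin k => ρ g) =
      (PiTensorProduct.map fun _ : Fin k => σ g) ∘ₗ PiTensorProduct.map fun _ : Fin k => f
    rw [← PiTensorProduct.map_comp, ← PiTensorProduct.map_comp]
    simp only [h]

/-- The embedding `u^{⊗k} → V^{⊗k}`. -/
noncomputable def inclPow (n k : ℕ) : (reflFunctor n).obj ⟨k⟩ ⟶ (permFunctor n).obj ⟨k⟩ :=
  powHom _ _ (reflIncl n) (reflIncl_comm n) k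

/-- The projection `V^{⊗k} → u^{⊗k}`. -/
noncomputable def projPow (n k : ℕ) : (permFunctor n).obj ⟨k⟩ ⟶ (reflFunctor n).obj ⟨k⟩ :=
  powHom _ _ (reflProj n) (reflProj_comm n) k

theorem inclPow_comp_projPow (n k : ℕ) : inclPow n k ≫ projPow n k = 𝟙 _ := by
  apply FDRep_hom_ext
  change (PiTensorProduct.map fun _ : Fin k => reflProj n) ∘ₗ
    (PiTensorProduct.map fun _ : Fin k => reflIncl n) = LinearMap.id
  rw [← PiTensorProduct.map_comp, reflProj_comp_reflIncl, PiTensorProduct.map_id]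

/-- The linear map underlying a morphism of representations. -/
noncomputable def underlying {G : Type} [Group G] (V W : FDRep ℂ G) :
    (V ⟶ W) →ₗ[ℂ] (V →ₗ[ℂ] W) where
  toFun f := f.hom.hom.hom
  map_add' _ _ := rfl
  map_smul' _ _ := rfl

theorem reflProj_single (n : ℕ) (v : Fin n × ℤˣ) :
    reflProj n (Pi.single v 1) = (rootHalf * sgn v.2) • Pi.single v.1 1 := by
  funext i
  change rootHalf * ∑ b, sgn b * (Pi.single v 1 : Fin n × ℤˣ → ℂ) (i, b) =
    (rootHalf * sgn v.2) * (Pi.single v.1 1 : Fin n → ℂ) i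
  rw [mul_assoc]
  congr 1
  by_cases h : i = v.1
  · subst h
    rw [Finset.sum_eq_single v.2 (fun b _ hb => by
      rw [Pi.single_eq_of_ne fun h => hb (Prod.ext_iff.1 h).2, mul_zero])
      (fun h => (h (Finset.mem_univ _)).elim)]
    simp
  · rw [Pi.single_eq_of_ne h, mul_zero]
    exact Finset.sum_eq_zero fun b _ => by
      rw [Pi.single_eq_of_ne fun h' => h (Prod.ext_iff.1 h').1, mul_zero]

theorem reflIncl_single (n : ℕ) (i : Fin n) :
    reflIncl n (Pi.single i 1) = ∑ b : ℤˣ, (rootHalf * sgn b) • Pi.single (i, b) 1 := by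
  funext v
  rw [Finset.sum_apply]
  change rootHalf * (sgn v.2 * (Pi.single i 1 : Fin n → ℂ) v.1) =
    ∑ b, (rootHalf * sgn b) * (Pi.single (i, b) 1 : Fin n × ℤˣ → ℂ) v
  by_cases h : v.1 = i
  · subst h
    rw [Finset.sum_eq_single v.2 (fun b _ hb => by
      rw [Pi.single_eq_of_ne fun h => hb (Prod.ext_iff.1 h).2.symm, mul_zero])
      (fun h => (h (Finset.mem_univ _)).elim)]
    simp
  · rw [Pi.single_eq_of_ne h, mul_zero, mul_zero]
    exact (Finset.sum_eq_zero fun b _ => by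
      rw [Pi.single_eq_of_ne fun h' => h (Prod.ext_iff.1 h').1, mul_zero]).symm

theorem map_reflProj_basis (n k : ℕ) (x : Fin k → Fin n × ℤˣ) :
    PiTensorProduct.map (fun _ => reflProj n) (tensorBasis (Fin n × ℤˣ) k x) =
      (∏ a, (rootHalf * sgn (x a).2)) • tensorBasis (Fin n) k fun a => (x a).1 := by
  simp only [tensorBasis, Basis.piTensorProduct_apply, Pi.basisFun_apply]
  refine (PiTensorProduct.map_tprod _ _).trans ?_
  rw [← MultilinearMap.map_smul_univ]
  exact congrArg _ (funext fun a => reflProj_single n (x a))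

theorem map_reflIncl_basis (n k : ℕ) (x : Fin k → Fin n) :
    PiTensorProduct.map (fun _ => reflIncl n) (tensorBasis (Fin n) k x) =
      ∑ b : Fin k → ℤˣ, (∏ a, (rootHalf * sgn (b a))) •
        tensorBasis (Fin n × ℤˣ) k fun a => (x a, b a) := by
  simp only [tensorBasis, Basis.piTensorProduct_apply, Pi.basisFun_apply]
  refine (PiTensorProduct.map_tprod _ _).trans ?_
  simp only [reflIncl_single]
  rw [MultilinearMap.map_sum]
  exact Finset.sum_congr rfl fun b _ => MultilinearMap.map_smul_univ _ _ _

theorem card_constOn {V : Type} [Finite V] (p : Setoid V) :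
    Nat.card {u : V → ℤˣ // ConstOn p u} = 2 ^ Nat.card (Quotient p) := by
  rw [Nat.card_congr (β := Quotient p → ℤˣ)
    { toFun := fun u => Quotient.lift u.1 u.2
      invFun := fun f => ⟨fun v => f (Quotient.mk _ v), fun a b h => congrArg f (Quotient.sound h)⟩
      left_inv := fun u => rfl
      right_inv := fun f => funext fun c => by induction c using Quotient.ind; rfl },
    Nat.card_fun, show Nat.card ℤˣ = 2 by rw [Nat.card_eq_fintype_card]; rfl]

/-- Let `s` be the signs of the basis indices `x` and `y`. After the substitution `u ↦ s * u` the
matrix entry asks that the positions and `u` be constant on blocks. Such `u` have sign `1` because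
`p` is even, and there are `2` to the number of blocks of them. -/
theorem sum_sgn_colKern (n : ℕ) {k l : ℕ} (p : EvenPart k l) (y : Fin l → Fin n × ℤˣ)
    (x : Fin k → Fin n × ℤˣ) :
    ∑ u : Fin k ⊕ Fin l → ℤˣ, sgn (∏ v, u v) * colKern (Fin n) ℂ (Col.mk p.1 u) y x =
      2 ^ Nat.card (Quotient p.1) * (sgn (∏ v, (Sum.elim x y v).2) *
        kern (Fin n) ℂ p.1 (fun a => (y a).1) (fun a => (x a).1)) := by
  classical
  let s : Fin k ⊕ Fin l → ℤˣ := fun v => (Sum.elim x y v).2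
  rw [← Equiv.sum_comp (Equiv.mulLeft s)]
  have h : ∀ u : Fin k ⊕ Fin l → ℤˣ, sgn (∏ v, (s * u) v) *
      colKern (Fin n) ℂ (Col.mk p.1 (s * u)) y x = if ConstOn p.1 u then
        sgn (∏ v, s v) * kern (Fin n) ℂ p.1 (fun a => (y a).1) (fun a => (x a).1) else 0 := by
    intro u
    have h1 : ColConst (Col.mk p.1 (s * u)) (Sum.elim x y) ↔
        ConstOn p.1 (Sum.elim (fun a => (x a).1) (fun a => (y a).1)) ∧ ConstOn p.1 u := by
      have h2 : (fun v => ((Sum.elim x y v).1, (Sum.elim x y v).2 * (s * u) v)) =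
          fun v => (Sum.elim (fun a => (x a).1) (fun a => (y a).1) v, u v) := by
        funext v
        refine Prod.ext ?_ ?_
        · rcases v with a | a <;> rfl
        · change s v * (s v * u v) = u v
          rw [← mul_assoc, Int.units_mul_self, one_mul]
      rw [colConst_mk, h2]
      simp only [ConstOn, Prod.mk.injEq]
      exact ⟨fun h => ⟨fun a b hab => (h a b hab).1, fun a b hab => (h a b hab).2⟩,
        fun h a b hab => ⟨h.1 a b hab, h.2 a b hab⟩⟩
    simp only [colKern, kern, h1]
    by_cases hu : ConstOn p.1 u
    · simp only [hu, and_true, if_true, Pi.mul_apply, Finset.prod_mul_distrib,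
        (isEven_iff p.1).1 p.2 u hu, mul_one]
    · simp only [hu, and_false, if_false, mul_zero]
  simp only [Equiv.coe_mulLeft, h]
  rw [← Finset.sum_filter, Finset.sum_const, nsmul_eq_mul, ← Fintype.card_subtype,
    ← Nat.card_eq_fintype_card, card_constOn]
  push_cast
  rfl

/-- With `r` blocks, `2 ^ ((k + l) / 2 - r)` from `Ω₀`, `2 ^ (-(k + l))` from the idempotents and `2
^ r` from the labellings combine to one factor `1/√2` per vertex. This explains the scaling of `Ω₀`
and of the embedding `u → V`; the integer division is exact because `k + l` is even. -/
theorem omegaPart_scalar {k l : ℕ} (p : EvenPart k l) :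
    (2 : ℂ) ^ (((k + l : ℤ) - 2 * Nat.card (Quotient p.1)) / 2) * ((1 / 2 : ℂ) ^ (k + l) *
      2 ^ Nat.card (Quotient p.1)) = rootHalf ^ (k + l) := by
  obtain ⟨a, ha⟩ := p.2.even_card
  generalize Nat.card (Quotient p.1) = r
  have h1 : ((k + l : ℤ) - 2 * r) / 2 = a - r := by omega
  rw [h1, ha, pow_add rootHalf, ← mul_pow, rootHalf_mul_self, zpow_sub₀ two_ne_zero, zpow_natCast,
    zpow_natCast, pow_add]
  have h2 : (2 : ℂ) ^ r ≠ 0 := pow_ne_zero _ two_ne_zero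
  field_simp
  rw [← mul_pow]
  norm_num

theorem tensorMap_sum {I A : Type} [Fintype I] [DecidableEq I] [Fintype A] {k l : ℕ}
    (M : A → Matrix (Fin l → I) (Fin k → I) ℂ) :
    tensorMap (∑ a, M a) = ∑ a, tensorMap (M a) :=
  map_sum (Matrix.toLin (tensorBasis I k) (tensorBasis I l)) M _

/-- The map of `Ω₀(p)` is the map of `p` on the image of `u^{⊗k}`. -/
theorem permFunctor_map_omegaPart (n : ℕ) {k l : ℕ} (p : EvenPart k l) :
    (permFunctor n).map (omegaPart (n : ℂ) p) =
      projPow n k ≫ (reflFunctor n).map (RepZero.ofPart _ p) ≫ inclPow n l := by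
  rw [reflFunctor_map_ofPart, omegaPart, sandwich_expand, Functor.map_smul, Functor.map_smul,
    Functor.map_sum]
  simp only [Functor.map_smul, permFunctor_map_ofCol]
  apply FDRep_hom_ext
  -- Both sides are compared as linear maps; `underlying` makes the passage linear, so that the sum
  -- over labels can be moved into the matrix.
  refine Eq.trans (b := underlying (tensorObj (permRep n) k) (tensorObj (permRep n) l)
    ((2 : ℂ) ^ (((k + l : ℤ) - 2 * Nat.card (Quotient p.1)) / 2) • (1 / 2 : ℂ) ^ (k + l) •
      ∑ u, sgn (∏ v, u v) • permMap n (Col.mk p.1 u))) rfl ?_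
  change _ = PiTensorProduct.map (fun _ : Fin l => reflIncl n) ∘ₗ
    tensorMap (kern (Fin n) ℂ p.1) ∘ₗ PiTensorProduct.map (fun _ : Fin k => reflProj n)
  refine Eq.trans (b := tensorMap ((2 : ℂ) ^ (((k + l : ℤ) - 2 * Nat.card (Quotient p.1)) / 2) •
    (1 / 2 : ℂ) ^ (k + l) • ∑ u, sgn (∏ v, u v) • colKern (Fin n) ℂ (Col.mk p.1 u))) ?_ ?_
  · rw [map_smul, map_smul, map_sum, tensorMap_smul, tensorMap_smul, tensorMap_sum]
    simp only [map_smul, tensorMap_smul]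
    rfl
  refine (tensorBasis (Fin n × ℤˣ) k).ext fun x => ?_
  rw [LinearMap.comp_apply, LinearMap.comp_apply, map_reflProj_basis, map_smul, map_smul, tensorMap,
    tensorMap, Matrix.toLin_self, Matrix.toLin_self, map_sum]
  simp only [map_smul, map_reflIncl_basis, Finset.smul_sum, smul_smul]
  -- Basis vectors of `V^{⊗l}` are split into positions `y`, which index `u^{⊗l}`, and signs `b`,
  -- which come from expanding the embedding.
  rw [← Equiv.sum_comp (Equiv.arrowProdEquivProdArrow (Fin l) (fun _ => Fin n) fun _ => ℤˣ).symm,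
    Fintype.sum_prod_type]
  refine Finset.sum_congr rfl fun y _ => Finset.sum_congr rfl fun b _ => ?_
  change _ • tensorBasis (Fin n × ℤˣ) l (fun a => (y a, b a)) = _
  congr 1
  rw [show (Equiv.arrowProdEquivProdArrow (Fin l) (fun _ => Fin n) fun _ => ℤˣ).symm (y, b) =
    fun a => (y a, b a) from rfl, Matrix.sum_apply]
  simp only [Matrix.smul_apply, smul_eq_mul, mul_assoc, ← Finset.mul_sum]
  rw [sum_sgn_colKern, ← mul_assoc ((1 / 2 : ℂ) ^ _), ← mul_assoc, omegaPart_scalar,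
    Fintype.prod_sum_type, map_mul, pow_add]
  simp only [Finset.prod_mul_distrib, Finset.prod_const, Finset.card_univ, Fintype.card_fin,
    Sum.elim_inl, Sum.elim_inr, map_prod]
  ring

theorem permFunctor_map_omegaMap (n : ℕ) {k l : ℕ} (f : (⟨k⟩ : RepZero (n : ℂ)) ⟶ ⟨l⟩) :
    (permFunctor n).map (omegaMap f) = projPow n k ≫ (reflFunctor n).map f ≫ inclPow n l := by
  induction f using RepZero.hom_induction with
  | zero => rw [map_zero, Functor.map_zero, Functor.map_zero, zero_comp, comp_zero]
  | plus f g hf hg => rw [map_add, Functor.map_add, Functor.map_add, hf, hg, Preadditive.add_comp,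
      Preadditive.comp_add]
  | smul r p => rw [map_smul, Functor.map_smul, Functor.map_smul, omegaMap_ofPart,
      permFunctor_map_omegaPart, Linear.smul_comp, Linear.comp_smul]

/-- The case of an identity: `H'` sends `e'^{⊗k}` to the projection of `V^{⊗k}` onto the copy of
`u^{⊗k}`. -/
theorem permFunctor_map_signIdemPow (n k : ℕ) :
    (permFunctor n).map (signIdemPow (2 * (n : ℂ)) k) = projPow n k ≫ inclPow n k := by
  rw [← omegaMap_id, permFunctor_map_omegaMap, CategoryTheory.Functor.map_id, Category.id_comp]

/-- As matrices both sides are the image of `f`, which absorbs the idempotents at either end. It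
reduces naturality over `Ω` to naturality of the extension `H` at `omegaMap f`. -/
theorem omega_map_comp_omegaIncl {t : ℂ} {k l : ℕ} (f : (⟨k⟩ : RepZero t) ⟶ ⟨l⟩) :
    (Omega t).map ((generators (RepZero t)).map f) ≫ omegaIncl t l =
      omegaIncl t k ≫ (generators (Par (2 * t))).map (omegaMap f) := by
  refine Idempotents.Karoubi.hom_ext _ _ ?_
  exact (Idempotents.Karoubi.comp_p ((Omega t).map ((generators (RepZero t)).map f))).trans
    (Idempotents.Karoubi.p_comp ((Omega t).map ((generators (RepZero t)).map f))).symm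

/-! ### The natural isomorphism `H Ω ≅ G` -/

variable {n : ℕ} (G : KarExtension (reflFunctor n)) (H : KarExtension (permFunctor n))

/-- The isomorphism `H(Ω([k])) ≅ u^{⊗k} ≅ G([k])`. -/
noncomputable def generatorIso (k : ℕ) :
    H.functor.obj ((Omega (n : ℂ)).obj ((generators (RepZero (n : ℂ))).obj ⟨k⟩)) ≅
      G.functor.obj ((generators (RepZero (n : ℂ))).obj ⟨k⟩) where
  hom := H.functor.map (omegaIncl n k) ≫ H.iso.hom.app ⟨k⟩ ≫ projPow n k ≫ G.iso.inv.app ⟨k⟩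
  inv := G.iso.hom.app ⟨k⟩ ≫ inclPow n k ≫ H.iso.inv.app ⟨k⟩ ≫ H.functor.map (omegaProj n k)
  hom_inv_id := by
    -- Naturality at `e'^{⊗k}` exchanges `projPow ≫ inclPow` for `H(e'^{⊗k})`, which factors as
    -- projection and inclusion of `Ω([k])` and is absorbed by them.
    have h := H.iso.hom.naturality (signIdemPow (2 * (n : ℂ)) k)
    rw [permFunctor_map_signIdemPow, Functor.comp_map, ← omegaProj_comp_omegaIncl] at h
    simp only [Category.assoc, Iso.inv_hom_id_app_assoc]
    rw [← reassoc_of% h, Iso.hom_inv_id_app_assoc, ← Functor.map_comp, ← Functor.map_comp,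
      Category.assoc, omegaIncl_comp_omegaProj, Category.comp_id, omegaIncl_comp_omegaProj,
      CategoryTheory.Functor.map_id]
  inv_hom_id := by
    have h := H.iso.hom.naturality (signIdemPow (2 * (n : ℂ)) k)
    rw [permFunctor_map_signIdemPow, Functor.comp_map, ← omegaProj_comp_omegaIncl,
      Functor.map_comp, Category.assoc] at h
    simp only [Category.assoc]
    rw [reassoc_of% h, Iso.inv_hom_id_app_assoc, reassoc_of% (inclPow_comp_projPow n k),
      reassoc_of% (inclPow_comp_projPow n k), Iso.hom_inv_id_app]
    rfl

/-- The isomorphisms on generators are natural because `H'(Ω₀(f))` is `f` framed by the projection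
and the embedding, and the embedding is a section of the projection. They extend since generators
are full and every object is a retract of a finite sum of them. -/
theorem exists_comparison : ∃ η : Omega (n : ℂ) ⋙ H.functor ≅ G.functor,
    ∀ k, comparison G H η k = inclPow n k := by
  have := G.additive
  have := H.additive
  let τ : generators (RepZero (n : ℂ)) ⋙ Omega (n : ℂ) ⋙ H.functor ≅
      generators (RepZero (n : ℂ)) ⋙ G.functor :=
    NatIso.ofComponents (fun X => generatorIso G H X.n) fun {X Y} f => by
      have h1 := H.iso.hom.naturality (omegaMap f)
      have h2 := G.iso.inv.naturality f
      have h3 := congrArg H.functor.map (omega_map_comp_omegaIncl f)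
      rw [Functor.map_comp, Functor.map_comp] at h3
      rw [Functor.comp_map, permFunctor_map_omegaMap] at h1
      simp only [Functor.comp_map, generatorIso, Category.assoc] at h2 ⊢
      rw [reassoc_of% h3, reassoc_of% h1, reassoc_of% (inclPow_comp_projPow n Y.n), h2]
  obtain ⟨η, hη⟩ := exists_iso_extending (generators (RepZero (n : ℂ))) envelopeRetract τ
  refine ⟨η, fun k => ?_⟩
  have h1 : η.inv.app ((generators (RepZero (n : ℂ))).obj ⟨k⟩) = τ.inv.app ⟨k⟩ := by
    rw [← cancel_epi (η.hom.app ((generators (RepZero (n : ℂ))).obj ⟨k⟩)), Iso.hom_inv_id_app, hη]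
    exact (τ.hom_inv_id_app _).symm
  have h := H.iso.hom.naturality (signIdemPow (2 * (n : ℂ)) k)
  rw [permFunctor_map_signIdemPow, Functor.comp_map, ← omegaProj_comp_omegaIncl,
    Functor.map_comp, Category.assoc] at h
  -- Going into `Ω([k])` and back is `H(e'^{⊗k})`, hence the projection onto the image of the
  -- embedding, which fixes that embedding.
  have h2 : inclPow n k ≫ H.iso.inv.app ⟨k⟩ ≫ H.functor.map (omegaProj (n : ℂ) k) ≫
      H.functor.map (omegaIncl (n : ℂ) k) ≫ H.iso.hom.app ⟨k⟩ = inclPow n k := by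
    rw [h, Iso.inv_hom_id_app_assoc, reassoc_of% (inclPow_comp_projPow n k)]
  refine Eq.trans ?_ h2
  rw [comparison, h1]
  change G.iso.inv.app ⟨k⟩ ≫ (G.iso.hom.app ⟨k⟩ ≫ inclPow n k ≫ H.iso.inv.app ⟨k⟩ ≫
    H.functor.map (omegaProj n k)) ≫ H.functor.map (omegaIncl n k) ≫ H.iso.hom.app ⟨k⟩ = _
  simp only [Category.assoc]
  exact Iso.inv_hom_id_app_assoc _ _ _

end Comparison

end Hyperoctahedral

/-! ### The main theorem -/

theorem mainTheorem2 (n : ℕ) :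
    (Hyperoctahedral.Omega (n : ℂ)).IsEquivalence ∧
    Nonempty (Hyperoctahedral.KarExtension (Hyperoctahedral.reflFunctor n)) ∧
    Nonempty (Hyperoctahedral.KarExtension (Hyperoctahedral.permFunctor n)) ∧
    (∀ (G : Hyperoctahedral.KarExtension (Hyperoctahedral.reflFunctor n))
        (H : Hyperoctahedral.KarExtension (Hyperoctahedral.permFunctor n)),
      ∃ (η : Hyperoctahedral.Omega (n : ℂ) ⋙ H.functor ≅ G.functor)
        (a : (Fin n → ℂ) →ₗ[ℂ] (Fin n × ℤˣ → ℂ)),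
        ∀ k : ℕ, (Hyperoctahedral.comparison G H η k).hom.hom.hom =
          PiTensorProduct.map fun _ : Fin k => a) ∧
    (∀ G : Hyperoctahedral.KarExtension (Hyperoctahedral.reflFunctor n),
      ∃ H : Hyperoctahedral.KarExtension (Hyperoctahedral.permFunctor n),
        Hyperoctahedral.Omega (n : ℂ) ⋙ H.functor = G.functor) := by
  obtain ⟨H₀⟩ := Hyperoctahedral.exists_karExtension (Hyperoctahedral.permFunctor n)
  refine ⟨inferInstance, Hyperoctahedral.exists_karExtension _, ⟨H₀⟩, fun G H => ?_, fun G => ?_⟩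
  · obtain ⟨η, hη⟩ := Hyperoctahedral.exists_comparison G H
    exact ⟨η, Hyperoctahedral.reflIncl n, fun k => by rw [hη]; rfl⟩
  -- The choice is `H = R ⋙ G` for a strict left inverse `R` of `Ω`. The auxiliary extension `H₀`
  -- serves only to show that `H` extends `H'`.
  · obtain ⟨R, hRa, hRl, hR, ⟨e⟩⟩ := Hyperoctahedral.exists_strict_inverse
      (Hyperoctahedral.Omega (n : ℂ)) Hyperoctahedral.omega_obj_injective
    obtain ⟨η, -⟩ := Hyperoctahedral.exists_comparison G H₀
    have h1 := G.additive
    have h2 := G.linear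
    refine ⟨⟨R ⋙ G.functor, inferInstance, inferInstance, ?_⟩, ?_⟩
    -- On generators: `R ⋙ G ≅ R ⋙ Ω ⋙ H₀ ≅ H₀ ≅ H'`.
    · exact Functor.isoWhiskerLeft (Hyperoctahedral.generators _ ⋙ R) η.symm ≪≫
        Functor.isoWhiskerLeft (Hyperoctahedral.generators _)
          (Functor.isoWhiskerRight e H₀.functor) ≪≫ H₀.iso
    · change (Hyperoctahedral.Omega (n : ℂ) ⋙ R) ⋙ G.functor = G.functor
      rw [hR]
      rfl
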